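/- Let $\overline{\mathbb Q}$ be an algebraic closure of $\mathbb Q$, let $g\in\{2,3\}$, and let $C$ be the smooth projective curve of genus $g$ given by $y^2=f(x)$, where $f=\sum_i f_ix^i\in\mathbb Q[x]$ is squarefree of degree $2g+1$ or $2g+2$. Let $\iota$ be the hyperelliptic involution. Put $D_\infty=2(\infty)$ if $\deg f=2g+1$ and $D_\infty=(\infty_1)+(\infty_2)$ if $\deg f=2g+2$. Let $J$ be the Jacobian of $C$. For $P_1,P_2\in C(\overline{\mathbb Q})$ write $\{P_1,P_2\}\in J(\overline{\mathbb Q})$ for the class of $(P_1)+(P_2)-D_\infty$. Let $\kappa\colon J\to K\subset\mathbb P^{2^g-1}$ be the quotient map onto the Kummer variety $K=J/\{\pm1\}$, in the coordinates of Cassels and Flynn ($g=2$) and of Stoll ($g=3$). Thus for affine points $P_i=(x_i,y_i)$ with $P_2\ne\iota(P_1)$ one has $$\kappa(\{P_1,P_2\})=(1:x_1+x_2:x_1x_2:\beta_0)\quad(g=2),$$ $$\kappa(\{P_1,P_2\})=(0:1:-S:N:S^2-N:-SN:N^2:\sigma_8),\quad S=x_1+x_2,\ N=x_1x_2\quad(g=3),$$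 where, if $x_1\neq x_2$, the last coordinates are $\beta_0=\frac{G-2y_1y_2}{(x_1-x_2)^2}$ and $\sigma_8=\frac{2y_1y_2-G}{(x_1-x_2)^2}$ with $G=2\sum_{j=0}^{g+1}f_{2j}(x_1x_2)^j+(x_1+x_2)\sum_{j=0}^{g}f_{2j+1}(x_1x_2)^j$. By a quadratic point we mean $P=(x,y)\in C(k)$ with $k/\mathbb Q$ a quadratic field and $x\notin\mathbb Q$; $\gamma(P)$ is its conjugate under the nontrivial automorphism $\gamma$ of $k$. We say that $\kappa^{-1}(R)$ is of the form $\{P,\gamma(P)\}$ if it is the orbit $\{Q,-Q\}$ of the class $Q=\{P,\gamma(P)\}$. We say that $R\in K(\mathbb Q)$ lifts to $J(\mathbb Q)$ if $R\in\kappa(J(\mathbb Q))$. (1) Let $g=2$ and $R=(1:\sigma_2:\sigma_3:\beta_0)\in K(\mathbb Q)$ with $\sigma_2,\sigma_3,\beta_0\in\mathbb Q$. Then $\kappa^{-1}(R)$ is of the form $\{P,\gamma(P)\}$ for some quadratic point $P$ if and only if $R$ lifts to $J(\mathbb Q)$, $\sigma_3\ne0$, and $\sigma_2^2-4\sigma_3$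 is not a square in $\mathbb Q$. In that case, for either choice of the square root, $$x(P)=\frac{\sigma_2+\sqrt{\sigma_2^2-4\sigma_3}}2,\qquad x(\gamma(P))=\frac{\sigma_2-\sqrt{\sigma_2^2-4\sigma_3}}2,$$ up to exchanging $P$ and $\gamma(P)$. (2) Let $g=3$ and $R=(0:\sigma_2:\sigma_3:\sigma_4:\sigma_5:\sigma_6:\sigma_7:\sigma_8)\in K(\mathbb Q)$ with all $\sigma_i\in\mathbb Q$. Put $\Delta=\sigma_3^2-4\sigma_2\sigma_4$. Then $\kappa^{-1}(R)$ is of the form $\{P,\gamma(P)\}$ for some quadratic point $P$ if and only if $R$ lifts to $J(\mathbb Q)$, $\sigma_2\ne0$, $\sigma_4\ne0$, and $\Delta$ is not a square in $\mathbb Q$. It is of this form with $P$ not a Weierstrass point if and only if, in addition, $\sigma_2x^2+\sigma_3x+\sigma_4$ does not divide $f$. Whenever $\kappa^{-1}(R)$ is of the form $\{P,\gamma(P)\}$, for either choice of the square root, $$x(P)=\frac{-\sigma_3+\sqrt{\Delta}}{2\sigma_2},\qquad x(\gamma(P))=\frac{-\sigma_3-\sqrt{\Delta}}{2\sigma_2},$$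 up to exchanging $P$ and $\gamma(P)$. -/

import Mathlib

open Polynomial

namespace HyperellipticKummer

noncomputable section

/-- A fixed algebraic closure of the rational numbers. -/
abbrev Qbar : Type := AlgebraicClosure ℚ

/-- Geometric points of the smooth projective curve `y ^ 2 = f(x)` of genus `g`, where
`f` is squarefree of degree `2g+1` or `2g+2`, viewed in the weighted projective plane with weights
`(1, g+1, 1)`: the affine points `(x : y : 1)` and the points at infinity `(1 : s : 0)`, where
`s ^ 2` is the coefficient of `x ^ (2g+2)` in `f` (so there is a single point at infinity in the
odd degree case, and there are two of them in the even degree case). -/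
inductive Pt (g : ℕ) (f : ℚ[X]) : Type
  | aff (x y : Qbar) (h : y ^ 2 = aeval x f) : Pt g f
  | inf (s : Qbar) (h : s ^ 2 = algebraMap ℚ Qbar (f.coeff (2 * g + 2))) : Pt g f

variable {g : ℕ} {f : ℚ[X]}

/-- First weighted homogeneous coordinate. -/
def Pt.hX : Pt g f → Qbar
  | .aff x _ _ => x
  | .inf _ _ => 1

/-- Weighted homogeneous coordinate of weight `g + 1`. -/
def Pt.hY : Pt g f → Qbar
  | .aff _ y _ => y
  | .inf s _ => s

/-- Last weighted homogeneous coordinate. -/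
def Pt.hZ : Pt g f → Qbar
  | .aff _ _ _ => 1
  | .inf _ _ => 0

/-- The affine `x`-coordinate (only used for affine points). -/
def Pt.xCoord (P : Pt g f) : Qbar := P.hX / P.hZ

/-- The hyperelliptic involution `(x : y : z) ↦ (x : -y : z)`. -/
def Pt.invol : Pt g f → Pt g f
  | .aff x y h => .aff x (-y) (by rw [neg_sq, h])
  | .inf s h => .inf (-s) (by rw [neg_sq, h])

/-- Weierstrass points are the fixed points of the hyperelliptic involution. -/
def Pt.IsWeierstrass (P : Pt g f) : Prop := P.invol = P

/-- The action of the absolute Galois group of `ℚ` on geometric points. -/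
def Pt.galois (τ : Qbar ≃ₐ[ℚ] Qbar) : Pt g f → Pt g f
  | .aff x y h => .aff (τ x) (τ y) (by
      rw [← map_pow, h]; exact (Polynomial.aeval_algHom_apply τ x f).symm)
  | .inf s h => .inf (τ s) (by rw [← map_pow, h]; exact τ.commutes _)

/-- The order of vanishing of the function `u(x) + v(x) y` at the point `(x₀, y₀)` of the affine
curve `y ^ 2 = F(x)`: the largest `n` such that the function lies in the `n`-th power of the maximal
ideal of the point. Polynomials in `x, y` are elements of `Qbar[X][X]`, the outer variable
being `y`. -/
def vanishingOrder (F : Qbar[X]) (x₀ y₀ : Qbar) (u v : Qbar[X]) : ℕ :=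
  sSup {n : ℕ | (C u + C v * X : Qbar[X][X]) ∈
    Ideal.span {C (X - C x₀), X - C (C y₀)} ^ n ⊔ Ideal.span {X ^ 2 - C F}}

/-- The order of vanishing at a point of the weighted homogeneous form of degree `n`
`z ^ n * u(x/z) + z ^ (n-g-1) * v(x/z) * y`, where `deg u ≤ n` and `deg v ≤ n - (g+1)`
(with `v = 0` if `n < g+1`). At a point at infinity it is computed in the chart `x = 1`, in which the
curve is `y ^ 2 = z ^ (2g+2) * f(1/z)`. -/
def formOrder (n : ℕ) (u v : Qbar[X]) : Pt g f → ℕ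
  | .aff x y _ => vanishingOrder (f.map (algebraMap ℚ Qbar)) x y u v
  | .inf s _ => vanishingOrder (reflect (2 * g + 2) (f.map (algebraMap ℚ Qbar))) 0 s
      (reflect n u) (reflect (n - (g + 1)) v)

/-- Divisors on the curve over `Qbar`. -/
abbrev Div (g : ℕ) (f : ℚ[X]) : Type := Pt g f →₀ ℤ

/-- The degree of a divisor. -/
def degree (g : ℕ) (f : ℚ[X]) : Div g f →+ ℤ :=
  Finsupp.liftAddHom fun _ => AddMonoidHom.id ℤ

/-- Divisors of degree zero. -/
abbrev degZero (g : ℕ) (f : ℚ[X]) : AddSubgroup (Div g f) := (degree g f).ker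

/-- The group of principal divisors. Every rational function is a quotient of two nonzero
functions `u(x) + v(x) y`, so it is generated by the divisors of the latter. Such a function
is the quotient of a form of degree `n` by the `n`-th power of the form `z`. -/
def principal (g : ℕ) (f : ℚ[X]) : AddSubgroup (Div g f) :=
  AddSubgroup.closure {D | ∃ (n : ℕ) (u v : Qbar[X]),
    g + 1 ≤ n ∧ u.natDegree ≤ n ∧ v.natDegree ≤ n - (g + 1) ∧ (u ≠ 0 ∨ v ≠ 0) ∧
    ∀ P : Pt g f, D P = (formOrder n u v P : ℤ) - n * (formOrder 1 1 0 P : ℤ)}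

/-- The geometric points of the Jacobian: divisors of degree zero modulo principal divisors. -/
abbrev Jac (g : ℕ) (f : ℚ[X]) : Type :=
  degZero g f ⧸ (principal g f).addSubgroupOf (degZero g f)

/-- The divisor at infinity: `2 (∞)` in the odd degree case and `(∞₁) + (∞₂)` in the even
degree case. -/
def divInf (g : ℕ) (f : ℚ[X]) : Div g f :=
  let s := IsAlgClosed.exists_pow_nat_eq (algebraMap ℚ Qbar (f.coeff (2 * g + 2))) (n := 2) two_pos
  Finsupp.single (Pt.inf s.choose s.choose_spec) 1 +
    Finsupp.single (Pt.inf s.choose s.choose_spec).invol 1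

/-- The divisor `(P₁) + (P₂) - D_∞` of degree zero. -/
def pairDiv (P₁ P₂ : Pt g f) : degZero g f :=
  ⟨Finsupp.single P₁ 1 + Finsupp.single P₂ 1 - divInf g f, by
    have h : ∀ P : Pt g f, degree g f (Finsupp.single P 1) = 1 := fun P => by simp [degree]
    rw [AddMonoidHom.mem_ker, divInf]
    simp only [map_sub, map_add, h, sub_self]⟩

/-- The class `{P₁, P₂}` of the divisor `(P₁) + (P₂) - D_∞`. -/
def pairClass (P₁ P₂ : Pt g f) : Jac g f := QuotientAddGroup.mk (pairDiv P₁ P₂)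

/-- Rational points of the Jacobian: the classes fixed by the absolute Galois group. -/
def IsRationalClass (Q : Jac g f) : Prop :=
  ∃ D : degZero g f, Q = QuotientAddGroup.mk D ∧
    ∀ τ : Qbar ≃ₐ[ℚ] Qbar, Finsupp.mapDomain (Pt.galois τ) (D : Div g f) - D ∈ principal g f

/-- A divisor in general position: effective, and not containing any `(P) + (ι P)`. -/
def InGeneralPosition (D : Div g f) : Prop :=
  0 ≤ D ∧ ∀ P : Pt g f, ¬ Finsupp.single P 1 + Finsupp.single P.invol 1 ≤ D

/-! ### Kummer coordinates -/

/-- The binary form of degree `2g+2` with dehomogenization `∑ cᵢ xⁱ`. -/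
def binForm {R : Type*} [CommRing R] (g : ℕ) (c : ℕ → R) (x z : R) : R :=
  ∑ i ∈ Finset.range (2 * g + 3), c i * x ^ i * z ^ (2 * g + 2 - i)

/-- The symmetric bihomogeneous form
`2 ∑ c₂ⱼ (x₁x₂)ʲ + (x₁ + x₂) ∑ c₂ⱼ₊₁ (x₁x₂)ʲ` (written here in the case `z₁ = z₂ = 1`). -/
def symForm {R : Type*} [CommRing R] (g : ℕ) (c : ℕ → R) (x₁ z₁ x₂ z₂ : R) : R :=
  2 * ∑ j ∈ Finset.range (g + 2), c (2 * j) * (x₁ * x₂) ^ j * (z₁ * z₂) ^ (g + 1 - j) +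
    (x₁ * z₂ + x₂ * z₁) *
      ∑ j ∈ Finset.range (g + 1), c (2 * j + 1) * (x₁ * x₂) ^ j * (z₁ * z₂) ^ (g - j)

/-- For two points with distinct `(x : z)` this is `(G - 2 y₁ y₂) / (x₁ z₂ - x₂ z₁) ^ 2`, where `G`
is `symForm`. This quantity `t` is a root of
`(x₁ z₂ - x₂ z₁) ^ 2 t ^ 2 - 2 G t + (G ^ 2 - 4 F F) / (x₁ z₂ - x₂ z₁) ^ 2 = 0`.
For a double point the equation becomes linear, `-4 y ^ 2 t + s₀ = 0`, and it gives `t`. There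
`s₀` is the value on the diagonal of the polynomial `(G ^ 2 - 4 F F) / (x₁ z₂ - x₂ z₁) ^ 2`; it is
the coefficient of `T ^ 2` in `G ^ 2 - 4 F F` when the second point is `(x + z T : z + (1 - z) T)`,
since then `(x₁ z₂ - x₂ z₁) ^ 2 = T ^ 2`. -/
def lastCoord (P₁ P₂ : Pt g f) : Qbar :=
  open Classical in
  if P₁.hX * P₂.hZ = P₂.hX * P₁.hZ then
    let c : ℕ → Qbar[X] := fun i => C (algebraMap ℚ Qbar (f.coeff i))
    let x : Qbar[X] := C P₁.hX
    let z : Qbar[X] := C P₁.hZ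
    (symForm g c x z (x + z * X) (z + (1 - z) * X) ^ 2 -
      4 * binForm g c x z * binForm g c (x + z * X) (z + (1 - z) * X)).coeff 2 / (4 * P₁.hY ^ 2)
  else
    (symForm g (fun i => algebraMap ℚ Qbar (f.coeff i)) P₁.hX P₁.hZ P₂.hX P₂.hZ
      - 2 * P₁.hY * P₂.hY) / (P₁.hX * P₂.hZ - P₂.hX * P₁.hZ) ^ 2

/-- Genus 2: `w` is a vector of homogeneous coordinates of `κ(Q)`, in the coordinates of Cassels and
Flynn; for `Q = {(x₁, y₁), (x₂, y₂)}` it is `(1 : x₁ + x₂ : x₁ x₂ : β₀)`. -/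
def IsKummerVec₂ (f : ℚ[X]) (Q : Jac 2 f) (w : Fin 4 → Qbar) : Prop :=
  (Q = 0 ∧ w = ![0, 0, 0, 1]) ∨
  ∃ P₁ P₂ : Pt 2 f, P₂ ≠ P₁.invol ∧ Q = pairClass P₁ P₂ ∧
    w = ![P₁.hZ * P₂.hZ, P₁.hX * P₂.hZ + P₂.hX * P₁.hZ, P₁.hX * P₂.hX, lastCoord P₁ P₂]

/-- Genus 3: `w` is a vector of homogeneous coordinates of `κ(Q)`, in the coordinates of Stoll.
If `Q = {(x₁, y₁), (x₂, y₂)}` with divisor in general position, then it is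
`(0 : a₀² : a₀a₁ : a₀a₂ : a₁² - a₀a₂ : a₁a₂ : a₂² : σ₈)`, where `a₀x² + a₁xz + a₂z²` has the roots
`(xᵢ : zᵢ)`. If `Q = [D - 2 D_∞]` with `D` of degree four in general position, then one writes
`f = B² - AC` with `A, B, C` of degree at most four (forms of degree four) such that `D` is cut out
by `A = 0, y = B`. With `mᵢⱼ = 2bᵢbⱼ - aᵢcⱼ - aⱼcᵢ` the coordinates are
`(1 : m₂₄ : m₁₄ : m₀₄ : m₀₄ + m₁₃ : m₀₃ : m₀₂ : κ₈)` with `κ₁κ₈ = κ₂κ₇ - κ₃κ₆ + κ₄κ₅`. -/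
def IsKummerVec₃ (f : ℚ[X]) (Q : Jac 3 f) (w : Fin 8 → Qbar) : Prop :=
  (Q = 0 ∧ w = ![0, 0, 0, 0, 0, 0, 0, 1]) ∨
  (∃ P₁ P₂ : Pt 3 f, P₂ ≠ P₁.invol ∧ Q = pairClass P₁ P₂ ∧
    let a₀ := P₁.hZ * P₂.hZ
    let a₁ := -(P₁.hX * P₂.hZ + P₂.hX * P₁.hZ)
    let a₂ := P₁.hX * P₂.hX
    w = ![0, a₀ ^ 2, a₀ * a₁, a₀ * a₂, a₁ ^ 2 - a₀ * a₂, a₁ * a₂, a₂ ^ 2, -lastCoord P₁ P₂]) ∨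
  (∃ (D : Div 3 f) (E : degZero 3 f) (A B C' : Qbar[X]),
    InGeneralPosition D ∧ degree 3 f D = 4 ∧
    (E : Div 3 f) = D - (2 : ℕ) • divInf 3 f ∧ Q = QuotientAddGroup.mk E ∧
    A.natDegree ≤ 4 ∧ B.natDegree ≤ 4 ∧ C'.natDegree ≤ 4 ∧
    f.map (algebraMap ℚ Qbar) = B ^ 2 - A * C' ∧
    (∀ P, D P = (min (formOrder 4 A 0 P) (formOrder 4 (-B) 1 P) : ℕ)) ∧
    let m : ℕ → ℕ → Qbar := fun i j =>
      2 * B.coeff i * B.coeff j - A.coeff i * C'.coeff j - A.coeff j * C'.coeff i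
    w = ![1, m 2 4, m 1 4, m 0 4, m 0 4 + m 1 3, m 0 3, m 0 2,
      m 2 4 * m 0 2 - m 1 4 * m 0 3 + m 0 4 * (m 0 4 + m 1 3)])

/-- The preimage under `κ` of the point of projective 3-space with rational coordinates `R`. -/
def kummerFiber₂ (f : ℚ[X]) (R : Fin 4 → ℚ) : Set (Jac 2 f) :=
  {Q | ∃ w, IsKummerVec₂ f Q w ∧ ∃ c : Qbar, c ≠ 0 ∧ ∀ i, algebraMap ℚ Qbar (R i) = c * w i}

/-- The preimage under `κ` of the point of projective 7-space with rational coordinates `R`. -/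
def kummerFiber₃ (f : ℚ[X]) (R : Fin 8 → ℚ) : Set (Jac 3 f) :=
  {Q | ∃ w, IsKummerVec₃ f Q w ∧ ∃ c : Qbar, c ≠ 0 ∧ ∀ i, algebraMap ℚ Qbar (R i) = c * w i}

/-! ### Quadratic points -/

/-- `P` is a quadratic point not lying above a rational point of the projective line, and `P'` is
its Galois conjugate: `P = (x, y)` and `P' = (γ x, γ y)` with `x, y` in a quadratic field `k`, where
`x` is not rational and `γ` is the nontrivial automorphism of `k`. -/
def IsQuadConj (P P' : Pt g f) : Prop :=
  ∃ k : IntermediateField ℚ Qbar, Module.finrank ℚ k = 2 ∧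
    ∃ (γ : k ≃ₐ[ℚ] k) (x y : k), γ ≠ 1 ∧ x ∉ Set.range (algebraMap ℚ k) ∧
      ∃ h h', P = .aff (x : Qbar) (y : Qbar) h ∧ P' = .aff (γ x : Qbar) (γ y : Qbar) h'

/-- The set `S` of points of the Jacobian (a fibre of `κ`, so an orbit `{Q, -Q}`) is of the form
`{P, γ(P)}`: it is the orbit of the class of a quadratic point and its conjugate. -/
def IsConjFiber (S : Set (Jac g f)) (P P' : Pt g f) : Prop :=
  IsQuadConj P P' ∧ S = {pairClass P P', -pairClass P P'}

end

end HyperellipticKummer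

/-!
The theorem rests on the fact that a class `{P₁, P₂}` with `P₂ ≠ ι P₁` determines the unordered pair
of points (`pairClass_eq_iff`). Hence the class is rational exactly when every Galois automorphism
fixes or exchanges the two points (`isRationalClass_pairClass_iff`). The Kummer coordinates give
`x₁ + x₂` and `x₁ x₂`. If these are rational and the discriminant is not a square, then `x₁` is
quadratic over `ℚ` and its conjugate is `x₂`. An automorphism that fixes `x₁` fixes the point, so
`y₁` lies in `ℚ(x₁)`, and `P₁`, `P₂` are conjugate quadratic points (`isQuadConj_of_galois`). The
converse direction and the formula for the `x`-coordinates are read off from the symmetric functions.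
That the fibre contains only `{P₁, P₂}` and its negative is `isAffinePairClass_iff`. In genus 3, `P₁`
is a Weierstrass point if and only if `f` vanishes at `x₁`, that is, if the minimal polynomial of `x₁`
divides `f`.

For the uniqueness of the pair, suppose that `(P₁) + (P₂) - (Q₁) - (Q₂)` is principal. Adding the
divisors `(Qᵢ) + (ι Qᵢ) - D_∞` of the functions `x - x(Qᵢ)` gives a function whose poles are bounded
by `2 D_∞`. Such a function is a polynomial in `x`, as `y` has too large a pole at infinity when
`g ≥ 2` (`exists_polynomial_of_bounded_poles`). So `(P₁) + (P₂) + (ι Q₁) + (ι Q₂)` is a sum of fibres of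
the `x`-coordinate map, and the pairs agree (`eq_pair_of_sub_mem_principal`).

Orders of vanishing are computed with Laurent series: at each point the functions `x` and `y` have
expansions `(ξ, η)` (`IsPlace`), which exist by Hensel's lemma, and the order of vanishing defined by
powers of the maximal ideal is the order of the expansion (`IsParam.mem_iff`). This makes it additive
on products and compatible with sums.
-/

namespace HyperellipticKummer

/-! ### Local parameters and orders of vanishing at a smooth point -/

section Local

variable {k : Type*} [Field k]

/-- `(p, q)` is a parametrization by power series of the formal neighbourhood of the smooth point
`(x₀, y₀)` of `y ^ 2 = F(x)`, normalized so that the variable is `x - x₀` if `y₀ ≠ 0`, and `y` if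
`y₀ = 0`; in the second case smoothness means `F'(x₀) ≠ 0`. -/
structure IsParam (F : k[X]) (x₀ y₀ : k) (p q : PowerSeries k) : Prop where
  constX : PowerSeries.constantCoeff p = x₀
  constY : PowerSeries.constantCoeff q = y₀
  eq : q ^ 2 = aeval p F
  unif : (y₀ ≠ 0 ∧ p = PowerSeries.C x₀ + PowerSeries.X) ∨
    (y₀ = 0 ∧ q = PowerSeries.X ∧ F.derivative.eval x₀ ≠ 0)

theorem constantCoeff_aeval (p : PowerSeries k) (u : k[X]) :
    PowerSeries.constantCoeff (aeval p u) = u.eval (PowerSeries.constantCoeff p) := by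
  rw [aeval_def, hom_eval₂, eval]
  congr 1

theorem isUnit_of_constantCoeff_ne {a : PowerSeries k} (h : PowerSeries.constantCoeff a ≠ 0) :
    IsUnit a := PowerSeries.isUnit_iff_constantCoeff.2 h.isUnit

/-- Hensel's lemma for power series, with an approximate root in the constants. -/
theorem exists_root_powerSeries (G : (PowerSeries k)[X]) (hG : G.Monic) (a : k)
    (h0 : PowerSeries.constantCoeff (G.eval (PowerSeries.C a)) = 0)
    (h1 : PowerSeries.constantCoeff (G.derivative.eval (PowerSeries.C a)) ≠ 0) :
    ∃ p : PowerSeries k, G.eval p = 0 ∧ PowerSeries.constantCoeff p = a := by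
  have H : HenselianRing (PowerSeries k) (Ideal.span {PowerSeries.X}) := inferInstance
  obtain ⟨p, hp, hpa⟩ := H.is_henselian G hG (PowerSeries.C a)
    (Ideal.mem_span_singleton.2 (PowerSeries.X_dvd_iff.2 h0))
    ((isUnit_of_constantCoeff_ne h1).map _)
  refine ⟨p, hp, ?_⟩
  have := PowerSeries.X_dvd_iff.1 (Ideal.mem_span_singleton.1 hpa)
  simpa [sub_eq_zero] using this

/-- If `y₀ ≠ 0`, Hensel's lemma extracts the square root of `F(x₀ + t)` with constant term `y₀`; if
`y₀ = 0`, it solves `F(p) = t ^ 2` for `p`, after `F` has been made monic. -/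
theorem exists_isParam [CharZero k] (F : k[X]) (x₀ y₀ : k) (h : y₀ ^ 2 = F.eval x₀)
    (hs : y₀ = 0 → F.derivative.eval x₀ ≠ 0) : ∃ p q, IsParam F x₀ y₀ p q := by
  by_cases hy : y₀ = 0
  · have hd := hs hy
    have hF0 : F ≠ 0 := by rintro rfl; simp at hd
    have hlc : F.leadingCoeff ≠ 0 := leadingCoeff_ne_zero.2 hF0
    have hdeg : 0 < F.natDegree := by
      by_contra hc
      rw [eq_C_of_natDegree_eq_zero (by omega : F.natDegree = 0)] at hd
      simp at hd
    let c : PowerSeries k := PowerSeries.C F.leadingCoeff⁻¹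
    have hM : ((F * C F.leadingCoeff⁻¹).map (algebraMap k (PowerSeries k))).Monic :=
      (monic_mul_leadingCoeff_inv hF0).map _
    have hval : ∀ p : PowerSeries k,
        ((F * C F.leadingCoeff⁻¹).map (algebraMap k (PowerSeries k))).eval p = aeval p F * c := by
      intro p
      rw [eval_map_algebraMap, map_mul, aeval_C, PowerSeries.algebraMap_apply]
      rfl
    obtain ⟨p, hp, hpx⟩ := exists_root_powerSeries
      ((F * C F.leadingCoeff⁻¹).map (algebraMap k (PowerSeries k)) - C (PowerSeries.X ^ 2 * c))
      (by
        refine hM.sub_of_left ?_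
        refine lt_of_le_of_lt degree_C_le ?_
        rw [← natDegree_pos_iff_degree_pos, natDegree_map_eq_of_injective
          (algebraMap k (PowerSeries k)).injective, natDegree_mul_C (inv_ne_zero hlc)]
        exact hdeg) x₀
      (by
        rw [eval_sub, hval, eval_C]
        simp [constantCoeff_aeval, ← h, hy])
      (by
        rw [derivative_sub, derivative_C, sub_zero, derivative_map, eval_map_algebraMap,
          constantCoeff_aeval]
        simp [hd, hF0])
    refine ⟨p, PowerSeries.X, ⟨hpx, by simp [hy], ?_, Or.inr ⟨hy, rfl, hd⟩⟩⟩
    rw [eval_sub, hval, eval_C, ← sub_mul, mul_eq_zero] at hp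
    rcases hp with hp | hp
    · exact (sub_eq_zero.1 hp).symm
    · exact absurd hp (by simp [c, hF0])
  · obtain ⟨q, hq, hqy⟩ := exists_root_powerSeries
      (X ^ 2 - C (aeval (PowerSeries.C x₀ + PowerSeries.X) F)) (monic_X_pow_sub_C _ two_ne_zero) y₀
      (by simp [constantCoeff_aeval, h])
      (by simp [hy])
    refine ⟨_, q, ⟨by simp, hqy, ?_, Or.inl ⟨hy, rfl⟩⟩⟩
    simpa [sub_eq_zero] using hq

theorem IsParam.neg {F : k[X]} {x₀ y₀ : k} {p q : PowerSeries k} (h : IsParam F x₀ y₀ p q)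
    (hy : y₀ ≠ 0) : IsParam F x₀ (-y₀) p (-q) :=
  ⟨h.constX, by simp [h.constY], by rw [neg_sq, h.eq], Or.inl ⟨neg_ne_zero.2 hy, by
    rcases h.unif with h | h
    · exact h.2
    · exact absurd h.1 hy⟩⟩

/-- The ring homomorphism `k[x][y] → k⟦t⟧`, `x ↦ p`, `y ↦ q`. -/
noncomputable def paramEval (p q : PowerSeries k) : k[X][X] →+* PowerSeries k :=
  eval₂RingHom (aeval p : k[X] →ₐ[k] PowerSeries k).toRingHom q

@[simp] theorem paramEval_C (p q : PowerSeries k) (u : k[X]) :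
    paramEval p q (C u) = aeval p u := by simp [paramEval]

@[simp] theorem paramEval_X (p q : PowerSeries k) :
    paramEval p q X = q := by simp [paramEval]

theorem constantCoeff_paramEval (p q : PowerSeries k) (h : k[X][X]) :
    PowerSeries.constantCoeff (paramEval p q h) =
      (h.eval (C (PowerSeries.constantCoeff q))).eval (PowerSeries.constantCoeff p) := by
  induction h using Polynomial.induction_on' with
  | add a b ha hb => simp [ha, hb]
  | monomial n a => simp [← C_mul_X_pow_eq_monomial, constantCoeff_aeval]

theorem mem_of_C_C_mul_mem {J : Ideal k[X][X]} {a : k} (ha : a ≠ 0) {b : k[X][X]}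
    (h : C (C a) * b ∈ J) : b ∈ J := by
  have := J.mul_mem_left (C (C a⁻¹)) h
  rwa [← mul_assoc, ← C_mul, ← C_mul, inv_mul_cancel₀ ha, C_1, C_1, one_mul] at this

/-- One of `x - x₀` and `y` is a preimage `π` of the variable, and it generates the maximal ideal `m`
of the point modulo `m ^ 2` and the equation of the curve. -/
theorem IsParam.exists_uniformizer [CharZero k] {F : k[X]} {x₀ y₀ : k} {p q : PowerSeries k}
    (h : IsParam F x₀ y₀ p q) : ∃ π : k[X][X], paramEval p q π = PowerSeries.X ∧
      π ∈ Ideal.span {C (X - C x₀), X - C (C y₀)} ∧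
      Ideal.span {C (X - C x₀), X - C (C y₀)} ≤
        Ideal.span {π} ⊔ Ideal.span {C (X - C x₀), X - C (C y₀)} ^ 2 ⊔
          Ideal.span {X ^ 2 - C F} := by
  set m : Ideal k[X][X] := Ideal.span {C (X - C x₀), X - C (C y₀)} with hm
  have hx : C (X - C x₀) ∈ m := Ideal.subset_span (by simp)
  have hy : X - C (C y₀) ∈ m := Ideal.subset_span (by simp)
  have hF0 : F.eval x₀ = y₀ ^ 2 := by
    have := congrArg PowerSeries.constantCoeff h.eq
    rw [constantCoeff_aeval, h.constX, map_pow, h.constY] at this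
    exact this.symm
  rcases h.unif with ⟨hy0, hp⟩ | ⟨hy0, hq, hd⟩
  · refine ⟨C (X - C x₀), by simp [hp], hx, ?_⟩
    set J := Ideal.span {C (X - C x₀)} ⊔ m ^ 2 ⊔ Ideal.span {X ^ 2 - C F} with hJ
    have h1 : C (X - C x₀) ∈ J :=
      Ideal.mem_sup_left (Ideal.mem_sup_left (Ideal.mem_span_singleton_self _))
    have h2 : (X - C (C y₀)) ^ 2 ∈ J :=
      Ideal.mem_sup_left (Ideal.mem_sup_right (Ideal.pow_mem_pow hy 2))
    have h3 : (X ^ 2 - C F : k[X][X]) ∈ J := Ideal.mem_sup_right (Ideal.mem_span_singleton_self _)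
    obtain ⟨G, hG⟩ : X - C x₀ ∣ F - C (y₀ ^ 2) := by
      rw [dvd_iff_isRoot]; simp [hF0]
    have h4 : C (C (2 * y₀)) * (X - C (C y₀)) ∈ J := by
      have : C (C (2 * y₀)) * (X - C (C y₀)) =
          (X ^ 2 - C F) + C G * C (X - C x₀) - (X - C (C y₀)) ^ 2 := by
        rw [← C_mul, mul_comm G, ← hG]
        simp only [map_sub, map_mul, map_pow, map_ofNat]
        ring
      rw [this]
      exact J.sub_mem (J.add_mem h3 (J.mul_mem_left _ h1)) h2
    have h5 : X - C (C y₀) ∈ J :=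
      mem_of_C_C_mul_mem (mul_ne_zero two_ne_zero hy0) h4
    rw [hm, Ideal.span_le]
    rintro a (rfl | rfl)
    · exact h1
    · exact h5
  · subst hy0
    refine ⟨X, by simp [hq], by simpa using hy, ?_⟩
    set J := Ideal.span {X} ⊔ m ^ 2 ⊔ Ideal.span {X ^ 2 - C F} with hJ
    have h1 : (X : k[X][X]) ∈ J :=
      Ideal.mem_sup_left (Ideal.mem_sup_left (Ideal.mem_span_singleton_self _))
    have h2 : C (X - C x₀) ^ 2 ∈ J :=
      Ideal.mem_sup_left (Ideal.mem_sup_right (Ideal.pow_mem_pow hx 2))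
    have h3 : (X ^ 2 - C F : k[X][X]) ∈ J := Ideal.mem_sup_right (Ideal.mem_span_singleton_self _)
    obtain ⟨G, hG⟩ : X - C x₀ ∣ F := by
      rw [dvd_iff_isRoot]; simp [hF0]
    have hG0 : G.eval x₀ ≠ 0 := by
      rw [hG] at hd
      simpa using hd
    obtain ⟨H, hH⟩ : X - C x₀ ∣ G - C (G.eval x₀) := by
      rw [dvd_iff_isRoot]; simp
    have h4 : C (C (G.eval x₀)) * C (X - C x₀) ∈ J := by
      have : C (C (G.eval x₀)) * C (X - C x₀) =
          X * X - (X ^ 2 - C F) - C H * C (X - C x₀) ^ 2 := by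
        have e : F = (X - C x₀) * (C (G.eval x₀) + (X - C x₀) * H) := by
          rw [← hH]; simpa using hG
        rw [show (C F : k[X][X]) = _ from congrArg C e]
        simp only [map_sub, map_mul, map_add]
        ring
      rw [this]
      exact J.sub_mem (J.sub_mem (J.mul_mem_left _ h1) h3) (J.mul_mem_left _ h2)
    have h5 : C (X - C x₀) ∈ J :=
      mem_of_C_C_mul_mem hG0 h4
    rw [hm, Ideal.span_le]
    rintro a (rfl | rfl)
    · exact h5
    · simpa using h1

/-- If `π` generates `m` modulo `m ^ 2` and `I`, then `π ^ n` generates `m ^ n` modulo `m ^ (n + 1)` and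
`I`. -/
theorem pow_le_span_pow_sup {R : Type*} [CommRing R] (m I : Ideal R) (π : R) (hπ : π ∈ m)
    (h : m ≤ Ideal.span {π} ⊔ m ^ 2 ⊔ I) (n : ℕ) :
    m ^ n ≤ Ideal.span {π ^ n} ⊔ m ^ (n + 1) ⊔ I := by
  induction n with
  | zero => simp
  | succ n ih =>
    have e : m ^ (n + 1) ≤ (Ideal.span {π ^ n} ⊔ m ^ (n + 1) ⊔ I) * m := by
      rw [pow_succ]; exact Ideal.mul_mono_left ih
    refine e.trans ?_
    rw [Ideal.sup_mul, Ideal.sup_mul]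
    refine sup_le (sup_le ?_ ?_) ?_
    · refine (Ideal.mul_mono_right h).trans ?_
      rw [Ideal.mul_sup, Ideal.mul_sup, Ideal.span_singleton_mul_span_singleton, ← pow_succ]
      refine sup_le (sup_le (le_sup_of_le_left le_sup_left) ?_)
        (le_sup_of_le_right Ideal.mul_le_right)
      refine le_sup_of_le_left (le_sup_of_le_right ?_)
      rw [show n + 1 + 1 = n + 2 by ring, pow_add]
      refine Ideal.mul_mono_left ?_
      rw [Ideal.span_singleton_le_iff_mem]
      exact Ideal.pow_mem_pow hπ n
    · rw [← pow_succ]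
      exact le_sup_of_le_left le_sup_right
    · exact le_sup_of_le_right Ideal.mul_le_left

/-- The filtration by powers of the maximal ideal, modulo the equation of the curve, is the `t`-adic
filtration of the expansions. An element of `m ^ n` is `π ^ n d` modulo `m ^ (n + 1)`, and when its
expansion is divisible by `t ^ (n + 1)`, then `d` vanishes at the point. -/
theorem IsParam.mem_iff [CharZero k] {F : k[X]} {x₀ y₀ : k} {p q : PowerSeries k}
    (h : IsParam F x₀ y₀ p q) (n : ℕ) (a : k[X][X]) :
    a ∈ Ideal.span {C (X - C x₀), X - C (C y₀)} ^ n ⊔ Ideal.span {X ^ 2 - C F} ↔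
      PowerSeries.X ^ n ∣ paramEval p q a := by
  set m : Ideal k[X][X] := Ideal.span {C (X - C x₀), X - C (C y₀)} with hm
  have hI : ∀ b ∈ Ideal.span {(X ^ 2 - C F : k[X][X])}, paramEval p q b = 0 := by
    intro b hb
    obtain ⟨c, rfl⟩ := Ideal.mem_span_singleton.1 hb
    simp [h.eq]
  have hfwd : ∀ (n : ℕ) (a), a ∈ m ^ n ⊔ Ideal.span {X ^ 2 - C F} →
      PowerSeries.X ^ n ∣ paramEval p q a := by
    intro n a ha
    obtain ⟨b, hb, c, hc, rfl⟩ := Submodule.mem_sup.1 ha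
    rw [map_add, hI c hc, add_zero]
    have hle : m ≤ (Ideal.span {PowerSeries.X}).comap (paramEval p q) := by
      rw [hm, Ideal.span_le]
      rintro a (rfl | rfl) <;>
      · simp only [SetLike.mem_coe, Ideal.mem_comap, Ideal.mem_span_singleton,
          PowerSeries.X_dvd_iff, constantCoeff_paramEval]
        simp [h.constX, h.constY]
    have := (Ideal.pow_right_mono hle n).trans (Ideal.le_comap_pow _ n) hb
    rwa [Ideal.mem_comap, Ideal.span_singleton_pow, Ideal.mem_span_singleton] at this
  refine ⟨hfwd n a, ?_⟩
  obtain ⟨π, hπ, hπm, hle⟩ := h.exists_uniformizer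
  induction n with
  | zero => intro; simp
  | succ n ih =>
    intro hd
    have h1 := ih ((pow_dvd_pow _ (Nat.le_succ n)).trans hd)
    have h2 := (sup_le (pow_le_span_pow_sup m _ π hπm hle n) le_sup_right) h1
    rw [sup_assoc] at h2
    obtain ⟨b, hb, c, hc, rfl⟩ := Submodule.mem_sup.1 h2
    obtain ⟨d, rfl⟩ := Ideal.mem_span_singleton.1 hb
    have h3 := hfwd _ _ hc
    rw [map_add, map_mul, map_pow, hπ] at hd
    have h4 := (Nat.succ_eq_add_one n ▸ (dvd_add_left h3).1 hd)
    rw [pow_succ] at h4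
    have h5 := (mul_dvd_mul_iff_left (pow_ne_zero n PowerSeries.X_ne_zero)).1 h4
    rw [PowerSeries.X_dvd_iff, constantCoeff_paramEval, h.constX, h.constY,
      ← mem_span_C_X_sub_C_X_sub_C_iff_eval_eval_eq_zero] at h5
    refine Ideal.add_mem _ (Ideal.mem_sup_left ?_) hc
    rw [pow_succ m]
    exact Ideal.mul_mem_mul (Ideal.pow_mem_pow hπm n) h5

end Local

/-! ### Orders of Laurent series -/

section Laurent

variable {k : Type*} [Field k]

/-- The inclusion of power series into Laurent series. -/
noncomputable def toLaurent (k : Type*) [Field k] : PowerSeries k →ₐ[k] LaurentSeries k :=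
  { HahnSeries.ofPowerSeries ℤ k with
    commutes' := fun _ => rfl }

theorem toLaurent_injective : Function.Injective (toLaurent k) :=
  HahnSeries.ofPowerSeries_injective

theorem toLaurent_ne_zero {a : PowerSeries k} (h : a ≠ 0) : toLaurent k a ≠ 0 :=
  (map_ne_zero_iff _ toLaurent_injective).2 h

theorem order_toLaurent_X : (toLaurent k PowerSeries.X).order = 1 := by
  have : toLaurent k PowerSeries.X = HahnSeries.single 1 1 := HahnSeries.ofPowerSeries_X
  rw [this, HahnSeries.order_single one_ne_zero]

theorem order_toLaurent_of_constantCoeff_ne {a : PowerSeries k}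
    (h : PowerSeries.constantCoeff a ≠ 0) : (toLaurent k a).order = 0 := by
  have ha : a ≠ 0 := by rintro rfl; simp at h
  apply le_antisymm
  · apply HahnSeries.order_le_of_coeff_ne_zero
    have := HahnSeries.ofPowerSeries_apply_coeff (Γ := ℤ) a 0
    rw [Nat.cast_zero] at this
    change (HahnSeries.ofPowerSeries ℤ k a).coeff 0 ≠ 0
    rw [this]
    simpa using h
  · rw [HahnSeries.le_order_iff_forall (toLaurent_ne_zero ha)]
    intro j hj
    change (HahnSeries.ofPowerSeries ℤ k a).coeff j = 0
    rw [HahnSeries.ofPowerSeries_apply]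
    apply HahnSeries.embDomain_of_notMem_range
    rintro ⟨n, rfl⟩
    exact absurd hj (Int.natCast_nonneg n).not_gt

theorem exists_eq_X_pow_mul {a : PowerSeries k} (h : a ≠ 0) :
    ∃ (n : ℕ) (r : PowerSeries k), a = PowerSeries.X ^ n * r ∧
      PowerSeries.constantCoeff r ≠ 0 := by
  obtain ⟨r, hr⟩ := PowerSeries.X_pow_order_dvd (φ := a)
  generalize hn : a.order.toNat = n at hr
  refine ⟨n, r, hr, fun h0 => PowerSeries.coeff_order h ?_⟩
  rw [hn, hr]
  simpa [PowerSeries.coeff_X_pow_mul'] using h0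

theorem order_toLaurent_X_pow_mul (n : ℕ) {r : PowerSeries k}
    (h : PowerSeries.constantCoeff r ≠ 0) :
    (toLaurent k (PowerSeries.X ^ n * r)).order = n := by
  have hr : r ≠ 0 := by rintro rfl; simp at h
  rw [map_mul, map_pow, HahnSeries.order_mul (pow_ne_zero _ (toLaurent_ne_zero
    PowerSeries.X_ne_zero)) (toLaurent_ne_zero hr), HahnSeries.order_pow, order_toLaurent_X,
    order_toLaurent_of_constantCoeff_ne h]
  simp

theorem isGreatest_X_pow_dvd (n : ℕ) {r : PowerSeries k}
    (h : PowerSeries.constantCoeff r ≠ 0) :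
    IsGreatest {m : ℕ | PowerSeries.X ^ m ∣ PowerSeries.X ^ n * r} n := by
  refine ⟨dvd_mul_right _ _, fun m hm => ?_⟩
  by_contra! hlt
  have h1 := (pow_dvd_pow _ hlt).trans hm
  rw [pow_succ, mul_dvd_mul_iff_left (pow_ne_zero n PowerSeries.X_ne_zero),
    PowerSeries.X_dvd_iff] at h1
  exact h h1

theorem order_inv {a : LaurentSeries k} (h : a ≠ 0) : (a⁻¹).order = -a.order := by
  have := HahnSeries.order_mul h (inv_ne_zero h)
  rw [mul_inv_cancel₀ h, HahnSeries.order_one] at this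
  omega

theorem order_add_ge {a b : LaurentSeries k} {m : ℤ} (ha : a = 0 ∨ m ≤ a.order)
    (hb : b = 0 ∨ m ≤ b.order) : a + b = 0 ∨ m ≤ (a + b).order := by
  rcases ha with rfl | ha
  · simpa using hb
  rcases hb with rfl | hb
  · simpa using Or.inr ha
  by_cases h : a + b = 0
  · exact Or.inl h
  · exact Or.inr ((le_min ha hb).trans (HahnSeries.min_order_le_order_add h))

theorem order_add_of_lt {a b : LaurentSeries k} (ha : a ≠ 0) (hb : b ≠ 0)
    (h : a.order < b.order) : (a + b).order = a.order := by
  have h' : a.orderTop < b.orderTop := by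
    rw [← HahnSeries.order_eq_orderTop_of_ne_zero ha, ← HahnSeries.order_eq_orderTop_of_ne_zero hb]
    exact_mod_cast h
  have h2 := HahnSeries.orderTop_add_eq_left h'
  have h3 : a + b ≠ 0 := by
    intro h0
    rw [h0, HahnSeries.orderTop_zero, eq_comm, HahnSeries.orderTop_eq_top] at h2
    exact ha h2
  rw [← HahnSeries.order_eq_orderTop_of_ne_zero ha,
    ← HahnSeries.order_eq_orderTop_of_ne_zero h3] at h2
  exact_mod_cast h2

open Classical in
/-- The ramification index of `(x, y) ↦ x` at a smooth point of `y ^ 2 = F(x)` with second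
coordinate `y`. -/
noncomputable def ramIndex (y : k) : ℤ := if y = 0 then 2 else 1

@[simp] theorem ramIndex_zero : ramIndex (0 : k) = 2 := by simp [ramIndex]

theorem ramIndex_of_ne {y : k} (h : y ≠ 0) : ramIndex y = 1 := by simp [ramIndex, h]

theorem ramIndex_neg (y : k) : ramIndex (-y) = ramIndex y := by
  by_cases h : y = 0
  · rw [h, neg_zero]
  · rw [ramIndex_of_ne h, ramIndex_of_ne (neg_ne_zero.2 h)]

/-- If `y₀ = 0`, then `t ^ 2 = F(p)` is `p - x₀` times a unit, so `p - x₀` has order two. -/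
theorem IsParam.order_sub {F : k[X]} {x₀ y₀ : k} {p q : PowerSeries k}
    (h : IsParam F x₀ y₀ p q) :
    (p - PowerSeries.C x₀ ≠ 0) ∧
      (toLaurent k (p - PowerSeries.C x₀)).order = ramIndex y₀ := by
  rcases h.unif with ⟨hy, rfl⟩ | ⟨rfl, rfl, hd⟩
  · simp [ramIndex_of_ne hy, order_toLaurent_X, PowerSeries.X_ne_zero]
  · have hF0 : F.eval x₀ = 0 := by
      have := congrArg PowerSeries.constantCoeff h.eq
      rw [constantCoeff_aeval, h.constX] at this
      simpa using this.symm
    obtain ⟨G, hG⟩ : X - C x₀ ∣ F := by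
      rw [dvd_iff_isRoot]; simp [hF0]
    have hG0 : G.eval x₀ ≠ 0 := by
      rw [hG] at hd
      simpa using hd
    have e : PowerSeries.X ^ 2 = (p - PowerSeries.C x₀) * aeval p G := by
      rw [h.eq, hG, map_mul]
      simp
    have hne : (PowerSeries.X : PowerSeries k) ^ 2 ≠ 0 := pow_ne_zero 2 PowerSeries.X_ne_zero
    have h1 : p - PowerSeries.C x₀ ≠ 0 := left_ne_zero_of_mul (e ▸ hne)
    have h2 : aeval p G ≠ 0 := right_ne_zero_of_mul (e ▸ hne)
    refine ⟨h1, ?_⟩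
    have h3 := congrArg (fun a => (toLaurent k a).order) e
    simp only [map_mul, map_pow] at h3
    rw [HahnSeries.order_mul (toLaurent_ne_zero h1) (toLaurent_ne_zero h2),
      order_toLaurent_of_constantCoeff_ne (a := aeval p G)
        (by rwa [constantCoeff_aeval, h.constX]), HahnSeries.order_pow, order_toLaurent_X] at h3
    rw [ramIndex_zero]
    simpa using h3.symm

theorem IsParam.order_y {F : k[X]} {x₀ y₀ : k} {p q : PowerSeries k}
    (h : IsParam F x₀ y₀ p q) :
    q ≠ 0 ∧ (toLaurent k q).order = ramIndex y₀ - 1 := by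
  rcases h.unif with ⟨hy, -⟩ | ⟨rfl, rfl, -⟩
  · rw [ramIndex_of_ne hy, sub_self]
    have hq : PowerSeries.constantCoeff q ≠ 0 := by rwa [h.constY]
    exact ⟨by rintro rfl; simp at hq, order_toLaurent_of_constantCoeff_ne hq⟩
  · simp [order_toLaurent_X, PowerSeries.X_ne_zero]

theorem aeval_toLaurent (p : PowerSeries k) (u : k[X]) :
    aeval (toLaurent k p) u = toLaurent k (aeval p u) :=
  aeval_algHom_apply _ _ _

theorem IsParam.order_aeval {F : k[X]} {x₀ y₀ : k} {p q : PowerSeries k}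
    (h : IsParam F x₀ y₀ p q) {u : k[X]} (hu : u ≠ 0) :
    aeval (toLaurent k p) u ≠ 0 ∧ (aeval (toLaurent k p) u).order =
      ramIndex y₀ * (u.rootMultiplicity x₀ : ℤ) := by
  obtain ⟨w, hw, hd⟩ := exists_eq_pow_rootMultiplicity_mul_and_not_dvd u hu x₀
  set m := u.rootMultiplicity x₀
  have hw0 : PowerSeries.constantCoeff (aeval p w) ≠ 0 := by
    rwa [constantCoeff_aeval, h.constX, Ne, ← IsRoot.def, ← dvd_iff_isRoot]
  have hw1 : aeval p w ≠ 0 := fun h0 => hw0 (by rw [h0, map_zero])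
  obtain ⟨h1, h2⟩ := h.order_sub
  have e : aeval p u = (p - PowerSeries.C x₀) ^ m * aeval p w := by
    rw [hw]; simp
  rw [aeval_toLaurent]
  refine ⟨toLaurent_ne_zero (e ▸ mul_ne_zero (pow_ne_zero _ h1) hw1), ?_⟩
  rw [e, map_mul, map_pow, HahnSeries.order_mul (pow_ne_zero _ (toLaurent_ne_zero h1))
    (toLaurent_ne_zero hw1), HahnSeries.order_pow, h2, order_toLaurent_of_constantCoeff_ne hw0,
    add_zero, nsmul_eq_mul, mul_comm]

theorem aeval_reflect {x : LaurentSeries k} (hx : x ≠ 0) {n : ℕ} {u : k[X]}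
    (hu : u.natDegree ≤ n) : aeval x (reflect n u) * x⁻¹ ^ n = aeval x⁻¹ u := by
  let _ : Invertible x⁻¹ := ⟨x, mul_inv_cancel₀ hx, inv_mul_cancel₀ hx⟩
  exact eval₂_reflect_mul_pow (algebraMap k (LaurentSeries k)) x⁻¹ n u hu

end Laurent

/-- The ideal-theoretic order of vanishing is the order of the Laurent expansion. The expansion has
to be nonzero, as otherwise the supremum is over an unbounded set. -/
theorem IsParam.vanishingOrder_eq {F : Qbar[X]} {x₀ y₀ : Qbar} {p q : PowerSeries Qbar}
    (h : IsParam F x₀ y₀ p q) {u v : Qbar[X]}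
    (huv : aeval (toLaurent Qbar p) u + aeval (toLaurent Qbar p) v * toLaurent Qbar q ≠ 0) :
    (vanishingOrder F x₀ y₀ u v : ℤ) =
      (aeval (toLaurent Qbar p) u + aeval (toLaurent Qbar p) v * toLaurent Qbar q).order := by
  rw [aeval_toLaurent, aeval_toLaurent, ← map_mul, ← map_add] at huv ⊢
  obtain ⟨n, r, hr, hr0⟩ := exists_eq_X_pow_mul (ne_of_apply_ne _ (huv.trans_eq (map_zero _).symm))
  rw [hr, order_toLaurent_X_pow_mul n hr0, vanishingOrder]
  simp_rw [h.mem_iff]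
  simp only [map_add, map_mul, paramEval_C, paramEval_X, hr]
  rw [(isGreatest_X_pow_dvd n hr0).csSup_eq]

/-! ### Laurent expansions at the points of the curve -/

section Places

variable {g : ℕ} {f : ℚ[X]}

theorem Pt.ext_iff' (P Q : Pt g f) : P = Q ↔ P.hX = Q.hX ∧ P.hY = Q.hY ∧ P.hZ = Q.hZ := by
  cases P <;> cases Q <;> simp [Pt.hX, Pt.hY, Pt.hZ]

@[simp] theorem Pt.hX_invol (P : Pt g f) : P.invol.hX = P.hX := by cases P <;> rfl
@[simp] theorem Pt.hY_invol (P : Pt g f) : P.invol.hY = -P.hY := by cases P <;> rfl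
@[simp] theorem Pt.hZ_invol (P : Pt g f) : P.invol.hZ = P.hZ := by cases P <;> rfl

@[simp] theorem Pt.invol_invol (P : Pt g f) : P.invol.invol = P := by
  simp [Pt.ext_iff']

theorem Pt.invol_injective : Function.Injective (Pt.invol : Pt g f → Pt g f) :=
  Function.LeftInverse.injective Pt.invol_invol

theorem Pt.invol_eq_self_iff (P : Pt g f) : P.invol = P ↔ P.hY = 0 := by
  simp [Pt.ext_iff', neg_eq_self]

/-- The polynomial `f` over `Qbar`. -/
noncomputable abbrev fbar (f : ℚ[X]) : Qbar[X] := f.map (algebraMap ℚ Qbar)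

theorem separable_fbar (hf : Squarefree f) : (fbar f).Separable :=
  (PerfectField.separable_iff_squarefree.2 hf).map

/-- `(ξ, η)` are the expansions of the functions `x` and `y` in Laurent series at a point of the curve.
At infinity they come from a parametrization `(p, q)` of the chart `y ^ 2 = z ^ (2g+2) f(1/z)`, in
which `x` is `1 / p` and `y` is `q / p ^ (g+1)`. -/
def IsPlace : Pt g f → LaurentSeries Qbar → LaurentSeries Qbar → Prop
  | .aff x y _, ξ, η => ∃ p q, IsParam (fbar f) x y p q ∧
      ξ = toLaurent Qbar p ∧ η = toLaurent Qbar q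
  | .inf s _, ξ, η => ∃ p q, IsParam (reflect (2 * g + 2) (fbar f)) 0 s p q ∧
      ξ = (toLaurent Qbar p)⁻¹ ∧ η = toLaurent Qbar q * ξ ^ (g + 1)

theorem exists_isPlace (hf : Squarefree f)
    (hd : f.natDegree = 2 * g + 1 ∨ f.natDegree = 2 * g + 2) (P : Pt g f) :
    ∃ ξ η, IsPlace P ξ η := by
  cases P with
  | aff x y h =>
    obtain ⟨p, q, hpq⟩ := exists_isParam (fbar f) x y (by rw [h, eval_map_algebraMap]) (by
      rintro rfl
      have hx : (fbar f).eval x = 0 := by rw [eval_map_algebraMap, ← h]; simp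
      exact (separable_fbar hf).eval₂_derivative_ne_zero (RingHom.id _) hx)
    exact ⟨_, _, p, q, hpq, rfl, rfl⟩
  | inf s h =>
    obtain ⟨p, q, hpq⟩ := exists_isParam (reflect (2 * g + 2) (fbar f)) 0 s (by
        rw [h, ← coeff_zero_eq_eval_zero, coeff_reflect]
        simp [revAt_le]) (by
      rintro rfl
      have h0 : f.coeff (2 * g + 2) = 0 := by simpa using h.symm
      have hd' : f.natDegree = 2 * g + 1 := by
        refine hd.resolve_right fun h2 => ?_
        rw [← h2, coeff_natDegree, leadingCoeff_eq_zero] at h0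
        simp [h0] at h2
      have h1 : f.coeff (2 * g + 1) ≠ 0 := by
        rw [← hd', coeff_natDegree, Ne, leadingCoeff_eq_zero]
        rintro rfl
        simp at hd'
      rw [← coeff_zero_eq_eval_zero, coeff_derivative, coeff_reflect, zero_add, revAt_le (by omega)]
      simpa using h1)
    exact ⟨_, _, p, q, hpq, rfl, rfl⟩

theorem IsPlace.neg {P : Pt g f} {ξ η : LaurentSeries Qbar} (h : IsPlace P ξ η)
    (hP : P.hY ≠ 0) : IsPlace P.invol ξ (-η) := by
  cases P with
  | aff x y _ =>
    obtain ⟨p, q, hpq, h1, h2⟩ := h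
    exact ⟨p, -q, hpq.neg hP, h1, by rw [h2, map_neg]⟩
  | inf s _ =>
    obtain ⟨p, q, hpq, h1, h2⟩ := h
    exact ⟨p, -q, hpq.neg hP, h1, by rw [h2, map_neg, neg_mul]⟩

/-- The ramification index of the `x`-coordinate map at a point. -/
noncomputable def Pt.ram (P : Pt g f) : ℤ := ramIndex P.hY

/-- The order of vanishing of a polynomial at the image of a point in the projective line. -/
noncomputable def Pt.val (P : Pt g f) (u : Qbar[X]) : ℤ :=
  match P with
  | .aff x _ _ => u.rootMultiplicity x
  | .inf _ _ => -u.natDegree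

/-- The integer such that `y` has order `ram * wt + (ram - 1)` (see `IsPlace.order_y`): `0` at affine
points and `-(g + 1)` at infinity, where `y` has a pole. -/
def Pt.wt (P : Pt g f) : ℤ :=
  match P with
  | .aff _ _ _ => 0
  | .inf _ _ => -(g + 1)

theorem Pt.ram_pos (P : Pt g f) : 0 < P.ram := by
  by_cases h : P.hY = 0
  · simp [Pt.ram, h]
  · simp [Pt.ram, ramIndex_of_ne h]

@[simp] theorem Pt.ram_invol (P : Pt g f) : P.invol.ram = P.ram := by
  rw [Pt.ram, Pt.hY_invol, ramIndex_neg, Pt.ram]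

@[simp] theorem Pt.val_invol (P : Pt g f) (u : Qbar[X]) : P.invol.val u = P.val u := by
  cases P <;> rfl

theorem natDegree_fbar_le (hd : f.natDegree = 2 * g + 1 ∨ f.natDegree = 2 * g + 2) :
    (fbar f).natDegree ≤ 2 * g + 2 := by
  rw [natDegree_map]; omega

theorem IsParam.toLaurent_ne_zero {F : Qbar[X]} {s : Qbar} {p q : PowerSeries Qbar}
    (h : IsParam F 0 s p q) : toLaurent Qbar p ≠ 0 := by
  exact HyperellipticKummer.toLaurent_ne_zero (by simpa using h.order_sub.1)

theorem IsParam.order_zero {F : Qbar[X]} {s : Qbar} {p q : PowerSeries Qbar}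
    (h : IsParam F 0 s p q) : (toLaurent Qbar p).order = ramIndex s := by
  simpa using h.order_sub.2

theorem IsPlace.eq (hd : f.natDegree = 2 * g + 1 ∨ f.natDegree = 2 * g + 2)
    {P : Pt g f} {ξ η : LaurentSeries Qbar} (h : IsPlace P ξ η) :
    η ^ 2 = aeval ξ (fbar f) := by
  cases P with
  | aff x y _ =>
    obtain ⟨p, q, hpq, rfl, rfl⟩ := h
    rw [aeval_toLaurent, ← hpq.eq, map_pow]
  | inf s _ =>
    obtain ⟨p, q, hpq, rfl, rfl⟩ := h
    rw [← aeval_reflect hpq.toLaurent_ne_zero (natDegree_fbar_le hd), aeval_toLaurent, ← hpq.eq,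
      map_pow]
    ring

theorem IsPlace.order_aeval {P : Pt g f} {ξ η : LaurentSeries Qbar} (h : IsPlace P ξ η)
    {u : Qbar[X]} (hu : u ≠ 0) :
    aeval ξ u ≠ 0 ∧ (aeval ξ u).order = P.ram * P.val u := by
  cases P with
  | aff x y _ =>
    obtain ⟨p, q, hpq, rfl, rfl⟩ := h
    exact hpq.order_aeval hu
  | inf s _ =>
    obtain ⟨p, q, hpq, rfl, rfl⟩ := h
    have h0 := hpq.toLaurent_ne_zero
    have hr : reflect u.natDegree u ≠ 0 := by rwa [Ne, reflect_eq_zero_iff]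
    have hm : rootMultiplicity 0 (reflect u.natDegree u) = 0 := by
      rw [rootMultiplicity_eq_zero_iff]
      intro hroot
      rw [IsRoot, ← coeff_zero_eq_eval_zero, coeff_reflect, revAt_le (Nat.zero_le _)] at hroot
      simp [hu] at hroot
    obtain ⟨h1, h2⟩ := hpq.order_aeval hr
    rw [← aeval_reflect h0 le_rfl]
    have h3 := pow_ne_zero u.natDegree (inv_ne_zero h0)
    refine ⟨mul_ne_zero h1 h3, ?_⟩
    rw [HahnSeries.order_mul h1 h3, h2, HahnSeries.order_pow, order_inv h0, hpq.order_zero, hm]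
    simp only [Pt.val, Pt.ram, Pt.hY, nsmul_eq_mul]
    push_cast
    ring

theorem IsPlace.order_y {P : Pt g f} {ξ η : LaurentSeries Qbar} (h : IsPlace P ξ η) :
    η ≠ 0 ∧ η.order = P.ram * P.wt + (P.ram - 1) := by
  cases P with
  | aff x y _ =>
    obtain ⟨p, q, hpq, rfl, rfl⟩ := h
    obtain ⟨h1, h2⟩ := hpq.order_y
    refine ⟨HyperellipticKummer.toLaurent_ne_zero h1, ?_⟩
    rw [h2]
    simp only [Pt.wt, Pt.ram, Pt.hY]
    ring
  | inf s _ =>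
    obtain ⟨p, q, hpq, rfl, rfl⟩ := h
    obtain ⟨h1, h2⟩ := hpq.order_y
    have h0 := hpq.toLaurent_ne_zero
    have h3 := pow_ne_zero (g + 1) (inv_ne_zero h0)
    have h4 := HyperellipticKummer.toLaurent_ne_zero h1
    refine ⟨mul_ne_zero h4 h3, ?_⟩
    rw [HahnSeries.order_mul h4 h3, h2, HahnSeries.order_pow, order_inv h0, hpq.order_zero]
    simp only [Pt.wt, Pt.ram, Pt.hY, nsmul_eq_mul]
    push_cast
    ring

/-- A nonconstant squarefree polynomial is not a square in the field of rational functions. -/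
theorem eq_zero_of_sq_eq (hf : Squarefree f) (hd : f.natDegree ≠ 0) {u v : Qbar[X]}
    (h : u ^ 2 = v ^ 2 * fbar f) : v = 0 := by
  by_contra hv
  have hdvd : v ∣ u := by
    rw [← UniqueFactorizationMonoid.pow_dvd_pow_iff_dvd two_ne_zero]
    exact ⟨_, h⟩
  obtain ⟨w, rfl⟩ := hdvd
  rw [mul_pow] at h
  have h1 := mul_left_cancel₀ (pow_ne_zero 2 hv) h
  have h2 : IsUnit w := (separable_fbar hf).squarefree w ⟨1, by rw [← h1]; ring⟩
  have h3 : IsUnit (fbar f) := h1 ▸ h2.pow 2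
  have := natDegree_eq_zero_of_isUnit h3
  rw [natDegree_map] at this
  exact hd this

/-- The expansion of a nonzero function `u + v y` is nonzero, since its norm `u ^ 2 - v ^ 2 f` is. -/
theorem IsPlace.ne_zero (hf : Squarefree f)
    (hd : f.natDegree = 2 * g + 1 ∨ f.natDegree = 2 * g + 2)
    {P : Pt g f} {ξ η : LaurentSeries Qbar} (h : IsPlace P ξ η) {u v : Qbar[X]}
    (huv : u ≠ 0 ∨ v ≠ 0) : aeval ξ u + aeval ξ v * η ≠ 0 := by
  intro h0
  have h1 : aeval ξ (u ^ 2 - v ^ 2 * fbar f) = 0 := by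
    simp only [map_sub, map_mul, map_pow]
    rw [← h.eq hd]
    linear_combination (aeval ξ u - aeval ξ v * η) * h0
  have h2 : u ^ 2 - v ^ 2 * fbar f = 0 := by
    by_contra h2
    exact (h.order_aeval h2).1 h1
  have hv := eq_zero_of_sq_eq hf (by omega) (sub_eq_zero.1 h2)
  subst hv
  simp at h2
  simp [h2] at huv

/-- The multiplicity of a point in the divisor of a function, as defined through forms of degree `n`, is
the order of the Laurent expansion of the function. -/
theorem IsPlace.formOrder_eq (hf : Squarefree f)
    (hd : f.natDegree = 2 * g + 1 ∨ f.natDegree = 2 * g + 2)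
    {P : Pt g f} {ξ η : LaurentSeries Qbar} (h : IsPlace P ξ η) {n : ℕ} {u v : Qbar[X]}
    (hn : g + 1 ≤ n) (hu : u.natDegree ≤ n) (hv : v.natDegree ≤ n - (g + 1))
    (huv : u ≠ 0 ∨ v ≠ 0) :
    (formOrder n u v P : ℤ) - n * (formOrder 1 1 0 P : ℤ) =
      (aeval ξ u + aeval ξ v * η).order := by
  have hne := h.ne_zero hf hd huv
  cases P with
  | aff x y _ =>
    obtain ⟨p, q, hpq, rfl, rfl⟩ := h
    simp only [formOrder]
    rw [hpq.vanishingOrder_eq hne, hpq.vanishingOrder_eq (by simp)]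
    simp
  | inf s _ =>
    obtain ⟨p, q, hpq, rfl, rfl⟩ := h
    have h0 := hpq.toLaurent_ne_zero
    have e : aeval (toLaurent Qbar p)⁻¹ u + aeval (toLaurent Qbar p)⁻¹ v *
        (toLaurent Qbar q * (toLaurent Qbar p)⁻¹ ^ (g + 1)) =
        (aeval (toLaurent Qbar p) (reflect n u) +
          aeval (toLaurent Qbar p) (reflect (n - (g + 1)) v) * toLaurent Qbar q) *
            (toLaurent Qbar p)⁻¹ ^ n := by
      rw [← aeval_reflect h0 hu, ← aeval_reflect h0 hv, add_mul,
        show n = (n - (g + 1)) + (g + 1) by omega, pow_add]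
      simp only [Nat.add_sub_cancel]
      ring
    rw [e] at hne ⊢
    have h1 := left_ne_zero_of_mul hne
    have h2 := right_ne_zero_of_mul hne
    simp only [formOrder]
    rw [hpq.vanishingOrder_eq h1, HahnSeries.order_mul h1 h2, HahnSeries.order_pow, order_inv h0]
    have e1 : reflect 1 (1 : Qbar[X]) = X := by rw [reflect_one, pow_one]
    rw [e1, hpq.vanishingOrder_eq (by simpa using h0)]
    simp [sub_eq_add_neg]

end Places

/-! ### Principal divisors with small poles -/

section Principal

variable {g : ℕ} {f : ℚ[X]}

theorem exists_pt_inf (g : ℕ) (f : ℚ[X]) :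
    ∃ s : Qbar, s ^ 2 = algebraMap ℚ Qbar (f.coeff (2 * g + 2)) :=
  IsAlgClosed.exists_pow_nat_eq _ two_pos

/-- A principal divisor is the divisor of one function `(u + v y) / c`, with a polynomial `c` in `x`
alone: these functions are closed under products, and inverses are found with the norm. -/
theorem exists_div_quotient (hf : Squarefree f)
    (hd : f.natDegree = 2 * g + 1 ∨ f.natDegree = 2 * g + 2) {D : Div g f}
    (hD : D ∈ principal g f) :
    ∃ u v c : Qbar[X], (u ≠ 0 ∨ v ≠ 0) ∧ c ≠ 0 ∧ ∀ (P : Pt g f) (ξ η), IsPlace P ξ η →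
      D P = (aeval ξ u + aeval ξ v * η).order - (aeval ξ c).order := by
  obtain ⟨s, hs⟩ := exists_pt_inf g f
  obtain ⟨ξ₀, η₀, hpl⟩ := exists_isPlace hf hd (.inf s hs)
  induction hD using AddSubgroup.closure_induction with
  | mem D hD =>
    obtain ⟨n, u, v, hn, hu, hv, huv, h⟩ := hD
    refine ⟨u, v, 1, huv, one_ne_zero, fun P ξ η hP => ?_⟩
    rw [h, hP.formOrder_eq hf hd hn hu hv huv]
    simp
  | zero => exact ⟨1, 0, 1, by simp, one_ne_zero, by simp⟩
  | add D E _ _ hD hE =>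
    obtain ⟨u, v, c, huv, hc, hD⟩ := hD
    obtain ⟨u', v', c', huv', hc', hE⟩ := hE
    have key : ∀ (P : Pt g f) (ξ η), IsPlace P ξ η →
        aeval ξ (u * u' + v * v' * fbar f) + aeval ξ (u * v' + v * u') * η =
          (aeval ξ u + aeval ξ v * η) * (aeval ξ u' + aeval ξ v' * η) := by
      intro P ξ η hP
      simp only [map_add, map_mul]
      rw [← hP.eq hd]
      ring
    refine ⟨u * u' + v * v' * fbar f, u * v' + v * u', c * c', ?_, mul_ne_zero hc hc',
      fun P ξ η hP => ?_⟩
    · by_contra! h0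
      have := key _ _ _ hpl
      rw [h0.1, h0.2, map_zero, zero_mul, add_zero] at this
      exact mul_ne_zero (hpl.ne_zero hf hd huv) (hpl.ne_zero hf hd huv') this.symm
    · rw [key P ξ η hP, Finsupp.add_apply, hD P ξ η hP, hE P ξ η hP, map_mul,
        HahnSeries.order_mul (hP.ne_zero hf hd huv) (hP.ne_zero hf hd huv'),
        HahnSeries.order_mul (hP.order_aeval hc).1 (hP.order_aeval hc').1]
      ring
  | neg D _ hD =>
    obtain ⟨u, v, c, huv, hc, hD⟩ := hD
    have key : ∀ (P : Pt g f) (ξ η), IsPlace P ξ η →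
        aeval ξ (u ^ 2 - v ^ 2 * fbar f) =
          (aeval ξ u + aeval ξ v * η) * (aeval ξ u + aeval ξ (-v) * η) := by
      intro P ξ η hP
      simp only [map_sub, map_mul, map_pow, map_neg]
      rw [← hP.eq hd]
      ring
    have huv' : u ≠ 0 ∨ -v ≠ 0 := by simpa using huv
    refine ⟨c * u, c * -v, u ^ 2 - v ^ 2 * fbar f, ?_, ?_, fun P ξ η hP => ?_⟩
    · simpa [hc] using huv
    · intro h0
      have := key _ _ _ hpl
      rw [h0, map_zero] at this
      exact mul_ne_zero (hpl.ne_zero hf hd huv) (hpl.ne_zero hf hd huv') this.symm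
    · rw [key P ξ η hP, Finsupp.neg_apply, hD P ξ η hP, map_mul, map_mul, mul_assoc, ← mul_add,
        HahnSeries.order_mul (hP.ne_zero hf hd huv) (hP.ne_zero hf hd huv'),
        HahnSeries.order_mul (hP.order_aeval hc).1 (hP.ne_zero hf hd huv')]
      ring

instance charZero_laurentSeries : CharZero (LaurentSeries Qbar) :=
  charZero_of_injective_algebraMap (algebraMap Qbar (LaurentSeries Qbar)).injective

theorem order_add_self (a : LaurentSeries Qbar) : (a + a).order = a.order := by
  rcases eq_or_ne a 0 with rfl | ha
  · simp
  · have h2 : (2 : LaurentSeries Qbar) = HahnSeries.C 2 := (map_ofNat HahnSeries.C 2).symm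
    rw [← two_mul, HahnSeries.order_mul two_ne_zero ha, h2, HahnSeries.order_C, zero_add]

theorem order_ge_of_add_sub {a b : LaurentSeries Qbar} {m : ℤ} (h1 : m ≤ (a + b).order)
    (h2 : m ≤ (a - b).order) : (a = 0 ∨ m ≤ a.order) ∧ (b = 0 ∨ m ≤ b.order) := by
  constructor
  · have := order_add_ge (Or.inr h1) (Or.inr h2)
    rwa [show a + b + (a - b) = a + a by ring, order_add_self, add_self_eq_zero] at this
  · rw [← HahnSeries.order_neg] at h2
    have := order_add_ge (Or.inr h1) (Or.inr h2)
    rwa [show a + b + -(a - b) = b + b by ring, order_add_self, add_self_eq_zero] at this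

/-- If `u + v y` has order at least `m` at a point and at its image under the hyperelliptic involution,
then so do `u` and `v y`. At an unramified point these are half the sum and half the difference of
`u + v y` and `u - v y`; at a Weierstrass point `u` has even order and `v y` has odd order. -/
theorem order_components_ge (hf : Squarefree f)
    (hd : f.natDegree = 2 * g + 1 ∨ f.natDegree = 2 * g + 2) (P : Pt g f) {u v : Qbar[X]} {m : ℤ}
    (h : ∀ ξ η, IsPlace P ξ η → m ≤ (aeval ξ u + aeval ξ v * η).order)
    (h' : ∀ ξ η, IsPlace P.invol ξ η → m ≤ (aeval ξ u + aeval ξ v * η).order) :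
    (u = 0 ∨ m ≤ P.ram * P.val u) ∧
      (v = 0 ∨ m ≤ P.ram * P.val v + (P.ram * P.wt + (P.ram - 1))) := by
  obtain ⟨ξ, η, hP⟩ := exists_isPlace hf hd P
  obtain ⟨hη, hη'⟩ := hP.order_y
  have h1 := h ξ η hP
  rcases eq_or_ne u 0 with rfl | hu
  · refine ⟨Or.inl rfl, ?_⟩
    rcases eq_or_ne v 0 with rfl | hv
    · exact Or.inl rfl
    · obtain ⟨hv0, hv1⟩ := hP.order_aeval hv
      rw [map_zero, zero_add, HahnSeries.order_mul hv0 hη, hv1, hη'] at h1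
      exact Or.inr h1
  obtain ⟨hu0, hu1⟩ := hP.order_aeval hu
  rcases eq_or_ne v 0 with rfl | hv
  · refine ⟨Or.inr ?_, Or.inl rfl⟩
    rwa [map_zero, zero_mul, add_zero, hu1] at h1
  obtain ⟨hv0, hv1⟩ := hP.order_aeval hv
  have hb := mul_ne_zero hv0 hη
  have hb1 : (aeval ξ v * η).order = P.ram * P.val v + (P.ram * P.wt + (P.ram - 1)) := by
    rw [HahnSeries.order_mul hv0 hη, hv1, hη']
  suffices H : (aeval ξ u = 0 ∨ m ≤ (aeval ξ u).order) ∧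
      (aeval ξ v * η = 0 ∨ m ≤ (aeval ξ v * η).order) by
    rw [← hu1, ← hb1]
    exact ⟨Or.inr (H.1.resolve_left hu0), Or.inr (H.2.resolve_left hb)⟩
  by_cases hy : P.hY = 0
  · have hr : P.ram = 2 := by rw [Pt.ram, hy, ramIndex_zero]
    rw [hr] at hu1 hb1
    rcases lt_trichotomy (aeval ξ u).order (aeval ξ v * η).order with hlt | heq | hlt
    · rw [order_add_of_lt hu0 hb hlt] at h1
      exact ⟨Or.inr h1, Or.inr (h1.trans hlt.le)⟩
    · omega
    · rw [add_comm, order_add_of_lt hb hu0 hlt] at h1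
      exact ⟨Or.inr (h1.trans hlt.le), Or.inr h1⟩
  · have h2 := h' ξ (-η) (hP.neg hy)
    rw [mul_neg, ← sub_eq_add_neg] at h2
    exact order_ge_of_add_sub h1 h2

theorem dvd_of_rootMultiplicity_le {c u : Qbar[X]} (hc : c ≠ 0)
    (h : u = 0 ∨ ∀ x, c.rootMultiplicity x ≤ u.rootMultiplicity x) : c ∣ u := by
  classical
  rcases eq_or_ne u 0 with rfl | hu
  · exact dvd_zero c
  · rw [IsAlgClosed.dvd_iff_roots_le_roots hc hu, Multiset.le_iff_count]
    simpa using h.resolve_left hu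

/-- A function whose only poles are at infinity, of order at most that of `2 D_∞`, is a polynomial
in `x`: it is `u + v y` with polynomials `u` and `v`, and `y` has order `-(g + 1) < -2` at infinity. -/
theorem exists_polynomial_of_bounded_poles (hf : Squarefree f)
    (hd : f.natDegree = 2 * g + 1 ∨ f.natDegree = 2 * g + 2) (hg : 2 ≤ g) {D : Div g f}
    (hD : D ∈ principal g f) (haff : ∀ x y h, 0 ≤ D (.aff x y h))
    (hinf : ∀ s h, -2 * (Pt.inf s h : Pt g f).ram ≤ D (.inf s h)) :
    ∃ u : Qbar[X], ∀ P : Pt g f, D P = P.ram * P.val u := by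
  obtain ⟨u, v, c, huv, hc, hD⟩ := exists_div_quotient hf hd hD
  have hcomp : ∀ x : Qbar,
      (u = 0 ∨ c.rootMultiplicity x ≤ u.rootMultiplicity x) ∧
      (v = 0 ∨ c.rootMultiplicity x ≤ v.rootMultiplicity x) := by
    intro x
    obtain ⟨y, hy⟩ := IsAlgClosed.exists_pow_nat_eq (aeval x f) two_pos
    have hP : ∀ P : Pt g f, 0 ≤ D P → ∀ ξ η, IsPlace P ξ η →
        P.ram * P.val c ≤ (aeval ξ u + aeval ξ v * η).order := by
      intro P hDP ξ η hP
      rw [← (hP.order_aeval hc).2]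
      have := hD P ξ η hP
      omega
    have hr := (Pt.aff x y hy : Pt g f).ram_pos
    obtain ⟨h1, h2⟩ := order_components_ge hf hd (Pt.aff x y hy) (hP _ (haff _ _ _))
      (by
        have := hP (Pt.aff x y hy : Pt g f).invol (haff _ _ _)
        rwa [Pt.ram_invol, Pt.val_invol] at this)
    refine ⟨h1.imp_right fun h => ?_, h2.imp_right fun h => ?_⟩
    · simpa [Pt.val] using le_of_mul_le_mul_left h hr
    · simp only [Pt.val, Pt.wt] at h
      by_contra! hlt
      have hlt' : (v.rootMultiplicity x : ℤ) + 1 ≤ c.rootMultiplicity x := by exact_mod_cast hlt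
      nlinarith
  obtain ⟨u, rfl⟩ := dvd_of_rootMultiplicity_le hc (u := u) (by
    by_contra! h
    obtain ⟨h0, x, hx⟩ := h
    exact absurd ((hcomp x).1.resolve_left h0) hx.not_ge)
  obtain ⟨v, rfl⟩ := dvd_of_rootMultiplicity_le hc (u := v) (by
    by_contra! h
    obtain ⟨h0, x, hx⟩ := h
    exact absurd ((hcomp x).2.resolve_left h0) hx.not_ge)
  have huv' : u ≠ 0 ∨ v ≠ 0 := by simpa [hc] using huv
  have hD' : ∀ (P : Pt g f) (ξ η), IsPlace P ξ η → D P = (aeval ξ u + aeval ξ v * η).order := by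
    intro P ξ η hP
    rw [hD P ξ η hP, map_mul, map_mul, mul_assoc, ← mul_add,
      HahnSeries.order_mul (hP.order_aeval hc).1 (hP.ne_zero hf hd huv')]
    ring
  have hv : v = 0 := by
    by_contra hv
    obtain ⟨s, hs⟩ := exists_pt_inf g f
    obtain ⟨-, h2⟩ := order_components_ge hf hd (Pt.inf s hs) (u := u) (v := v)
      (fun ξ η hP => (hinf s hs).trans_eq (hD' _ ξ η hP))
      (fun ξ η hP => by
        rw [← Pt.ram_invol]
        exact (hinf (-s) _).trans_eq (hD' _ ξ η hP))
    have h3 := h2.resolve_left hv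
    have hr := (Pt.inf s hs : Pt g f).ram_pos
    simp only [Pt.val, Pt.wt] at h3
    have hg' : (2 : ℤ) ≤ g := by exact_mod_cast hg
    nlinarith [Int.natCast_nonneg v.natDegree, mul_nonneg hr.le (Int.natCast_nonneg v.natDegree),
      mul_nonneg hr.le (sub_nonneg.2 hg')]
  subst hv
  refine ⟨u, fun P => ?_⟩
  obtain ⟨ξ, η, hP⟩ := exists_isPlace hf hd P
  rw [hD' P ξ η hP, map_zero, zero_mul, add_zero]
  exact (hP.order_aeval (by simpa using huv')).2

theorem Pt.eq_or_eq_invol {P Q : Pt g f} (hX : Q.hX = P.hX) (hZ : Q.hZ = P.hZ) :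
    Q = P ∨ Q = P.invol := by
  have h : Q.hY ^ 2 = P.hY ^ 2 := by
    cases P with
    | aff x y h =>
      cases Q with
      | aff x' y' h' =>
        obtain rfl : x' = x := hX
        exact h'.trans h.symm
      | inf s h => simp [Pt.hZ] at hZ
    | inf s h =>
      cases Q with
      | aff x' y' h' => simp [Pt.hZ] at hZ
      | inf s' h' => exact h'.trans h.symm
  rcases sq_eq_sq_iff_eq_or_eq_neg.1 h with h | h
  · exact Or.inl ((Pt.ext_iff' _ _).2 ⟨hX, h, hZ⟩)
  · exact Or.inr ((Pt.ext_iff' _ _).2 ⟨by simpa, by simpa, by simpa⟩)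

open Classical in
/-- The divisor `(P) + (ι P)` is a fibre of the `x`-coordinate map, with multiplicities. -/
theorem single_add_invol_apply (P Q : Pt g f) :
    (Finsupp.single P 1 + Finsupp.single P.invol 1 : Div g f) Q =
      if Q.hX = P.hX ∧ Q.hZ = P.hZ then Q.ram else 0 := by
  rw [Finsupp.add_apply, Finsupp.single_apply, Finsupp.single_apply]
  split_ifs with h1 h2 h3 h4 h5 h6 h7
  · subst h1
    have := P.invol_eq_self_iff.1 h2
    simp [Pt.ram, this]
  · subst h1; simp at h3
  · subst h1
    have : P.hY ≠ 0 := fun h => h2 (P.invol_eq_self_iff.2 h)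
    simp [Pt.ram, ramIndex_of_ne this]
  · subst h1; simp at h4
  · subst h5
    have : P.hY ≠ 0 := fun h => h1 (P.invol_eq_self_iff.2 h).symm
    rw [Pt.ram_invol, Pt.ram, ramIndex_of_ne this, zero_add]
  · subst h5; simp at h6
  · rcases Pt.eq_or_eq_invol h7.1 h7.2 with h | h
    · exact absurd h.symm h1
    · exact absurd h.symm h5
  · rfl

theorem divInf_aff (x y : Qbar) (h) : divInf g f (.aff x y h) = 0 := by
  rw [divInf, single_add_invol_apply]
  simp [Pt.hZ]

theorem divInf_inf (s : Qbar) (h) : divInf g f (.inf s h) = (Pt.inf s h : Pt g f).ram := by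
  rw [divInf, single_add_invol_apply]
  simp [Pt.hZ, Pt.hX]

theorem single_add_invol_eq_divInf (s : Qbar) (h) :
    (Finsupp.single (Pt.inf s h) 1 + Finsupp.single (Pt.inf s h).invol 1 : Div g f) =
      divInf g f := by
  ext Q
  rw [divInf, single_add_invol_apply, single_add_invol_apply]
  rfl

/-- The divisor of the function `x - x(P)`. -/
theorem single_add_invol_sub_mem (hf : Squarefree f)
    (hd : f.natDegree = 2 * g + 1 ∨ f.natDegree = 2 * g + 2) (P : Pt g f) :
    Finsupp.single P 1 + Finsupp.single P.invol 1 - divInf g f ∈ principal g f := by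
  classical
  cases P with
  | inf s h => rw [single_add_invol_eq_divInf, sub_self]; exact zero_mem _
  | aff x y h =>
    refine AddSubgroup.subset_closure ⟨g + 1, X - C x, 0, le_rfl, ?_, by simp,
      Or.inl (X_sub_C_ne_zero x), fun Q => ?_⟩
    · rw [natDegree_X_sub_C]; omega
    obtain ⟨ξ, η, hQ⟩ := exists_isPlace hf hd Q
    rw [hQ.formOrder_eq hf hd le_rfl (by rw [natDegree_X_sub_C]; omega) (by simp)
      (Or.inl (X_sub_C_ne_zero x)), map_zero, zero_mul, add_zero,
      (hQ.order_aeval (X_sub_C_ne_zero x)).2, Finsupp.sub_apply, single_add_invol_apply]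
    cases Q with
    | aff x' y' h' =>
      rw [divInf_aff]
      simp [Pt.val, Pt.hX, Pt.hZ, rootMultiplicity_X_sub_C]
    | inf s h' =>
      rw [divInf_inf]
      simp [Pt.val, Pt.hZ]

/-- An effective divisor of degree four that is a sum of fibres of the `x`-coordinate map, and contains
`(P₁) + (P₂)` with `P₂ ≠ ι P₁`, is `(P₁) + (ι P₁) + (P₂) + (ι P₂)`. -/
theorem eq_pair_of_invol_invariant {P₁ P₂ R₁ R₂ : Pt g f} (hne : P₂ ≠ P₁.invol) (E : Div g f)
    (hE : E = Finsupp.single P₁ 1 + Finsupp.single P₂ 1 + Finsupp.single R₁ 1 +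
      Finsupp.single R₂ 1)
    (hinv : ∀ P, E P.invol = E P) (heven : ∀ P : Pt g f, P.invol = P → Even (E P)) :
    (R₁ = P₁.invol ∧ R₂ = P₂.invol) ∨ (R₁ = P₂.invol ∧ R₂ = P₁.invol) := by
  classical
  have hval : ∀ P, E P = (if P₁ = P then 1 else 0) + (if P₂ = P then 1 else 0) +
      (if R₁ = P then 1 else 0) + (if R₂ = P then 1 else 0) := by
    intro P
    simp only [hE, Finsupp.add_apply, Finsupp.single_apply]
  have hne' : P₁ ≠ P₂.invol := by
    rintro rfl
    simp at hne
  have h1 := hinv P₁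
  have h2 := hinv P₂
  have h3 := heven P₁
  have h4 := heven P₂
  rw [hval, hval] at h1 h2
  rw [hval] at h3 h4
  have e1 : P₁.invol = P₂.invol ↔ P₁ = P₂ := Pt.invol_injective.eq_iff
  by_cases w1 : P₁.invol = P₁ <;> by_cases w2 : P₂.invol = P₂ <;> grind

/-- The hyperelliptic pencil is the only linear system of degree two and positive dimension: if
`(P₁) + (P₂)` is linearly equivalent to `(Q₁) + (Q₂)` and `P₂ ≠ ι P₁`, then the pairs agree. -/
theorem eq_pair_of_sub_mem_principal (hf : Squarefree f)
    (hd : f.natDegree = 2 * g + 1 ∨ f.natDegree = 2 * g + 2) (hg : 2 ≤ g) {P₁ P₂ Q₁ Q₂ : Pt g f}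
    (hne : P₂ ≠ P₁.invol)
    (h : (Finsupp.single P₁ 1 + Finsupp.single P₂ 1) -
      (Finsupp.single Q₁ 1 + Finsupp.single Q₂ 1) ∈ principal g f) :
    (Q₁ = P₁ ∧ Q₂ = P₂) ∨ (Q₁ = P₂ ∧ Q₂ = P₁) := by
  classical
  -- Adding `(Qᵢ) + (ι Qᵢ) - D_∞` moves the poles `Qᵢ` to infinity.
  set E : Div g f := Finsupp.single P₁ 1 + Finsupp.single P₂ 1 + Finsupp.single Q₁.invol 1 +
      Finsupp.single Q₂.invol 1 with hE
  have hmem : E - 2 • divInf g f ∈ principal g f := by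
    have := add_mem (add_mem h (single_add_invol_sub_mem hf hd Q₁))
      (single_add_invol_sub_mem hf hd Q₂)
    convert this using 1
    rw [hE]
    abel
  have hE0 : ∀ P, 0 ≤ E P := by
    intro P
    have hs : ∀ R : Pt g f, (0 : Div g f) ≤ Finsupp.single R 1 := fun R =>
      Finsupp.single_nonneg.2 zero_le_one
    exact add_nonneg (add_nonneg (add_nonneg (hs _) (hs _)) (hs _)) (hs _) P
  obtain ⟨u, hu⟩ := exists_polynomial_of_bounded_poles hf hd hg hmem
    (fun x y h => by
      rw [Finsupp.sub_apply, Finsupp.smul_apply, divInf_aff]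
      simpa using hE0 _)
    (fun s h => by
      rw [Finsupp.sub_apply, Finsupp.smul_apply, divInf_inf]
      have := hE0 (.inf s h)
      rw [nsmul_eq_mul]; push_cast
      linarith)
  have hEn : ∃ n : Pt g f → ℤ, (∀ P, n P.invol = n P) ∧ ∀ P, E P = P.ram * n P := by
    have hE' : ∀ P, E P = P.ram * P.val u + 2 * divInf g f P := fun P => by
      rw [← hu, Finsupp.sub_apply, Finsupp.smul_apply, nsmul_eq_mul]; push_cast; ring
    refine ⟨fun P => P.val u + if P.hZ = 0 then 2 else 0, fun P => by simp, fun P => ?_⟩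
    rw [hE']
    cases P with
    | aff x y h => simp [divInf_aff, Pt.hZ]
    | inf s h => rw [divInf_inf]; simp only [Pt.hZ, if_true]; ring
  obtain ⟨n, hn, hn'⟩ := hEn
  rcases eq_pair_of_invol_invariant hne E hE (fun P => by rw [hn', hn', hn, Pt.ram_invol])
    (fun P hP => by
      rw [hn', Pt.ram, P.invol_eq_self_iff.1 hP, ramIndex_zero]
      exact even_two_mul _) with h | h
  · exact Or.inl ⟨Pt.invol_injective h.1, Pt.invol_injective h.2⟩
  · exact Or.inr ⟨Pt.invol_injective h.1, Pt.invol_injective h.2⟩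

end Principal

/-! ### The Galois action on divisor classes -/

section Galois

variable {g : ℕ} {f : ℚ[X]}

/-- The action of a Galois automorphism on the coefficients of polynomials. -/
noncomputable def galPoly (τ : Qbar ≃ₐ[ℚ] Qbar) : Qbar[X] ≃+* Qbar[X] :=
  mapEquiv τ.toRingEquiv

@[simp] theorem galPoly_X (τ : Qbar ≃ₐ[ℚ] Qbar) : galPoly τ X = X := map_X _

@[simp] theorem galPoly_C (τ : Qbar ≃ₐ[ℚ] Qbar) (a : Qbar) : galPoly τ (C a) = C (τ a) :=
  map_C _

@[simp] theorem coeff_galPoly (τ : Qbar ≃ₐ[ℚ] Qbar) (u : Qbar[X]) (n : ℕ) :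
    (galPoly τ u).coeff n = τ (u.coeff n) :=
  coeff_map _ _

@[simp] theorem natDegree_galPoly (τ : Qbar ≃ₐ[ℚ] Qbar) (u : Qbar[X]) :
    (galPoly τ u).natDegree = u.natDegree :=
  natDegree_map_eq_of_injective τ.injective u

@[simp] theorem galPoly_fbar (τ : Qbar ≃ₐ[ℚ] Qbar) : galPoly τ (fbar f) = fbar f := by
  ext n
  simp

theorem galPoly_reflect (τ : Qbar ≃ₐ[ℚ] Qbar) (n : ℕ) (u : Qbar[X]) :
    galPoly τ (reflect n u) = reflect n (galPoly τ u) := by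
  ext i
  simp [coeff_reflect]

theorem vanishingOrder_galPoly (τ : Qbar ≃ₐ[ℚ] Qbar) (F : Qbar[X]) (x₀ y₀ : Qbar)
    (u v : Qbar[X]) :
    vanishingOrder (galPoly τ F) (τ x₀) (τ y₀) (galPoly τ u) (galPoly τ v) =
      vanishingOrder F x₀ y₀ u v := by
  let e : Qbar[X][X] ≃+* Qbar[X][X] := mapEquiv (galPoly τ)
  have hC : ∀ a, e (C a) = C (galPoly τ a) := fun a => map_C _
  have hX : e X = X := map_X _
  unfold vanishingOrder
  congr 1
  ext n
  simp only [Set.mem_ofPred_eq]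
  have h1 : (C (galPoly τ u) + C (galPoly τ v) * X : Qbar[X][X]) = e (C u + C v * X) := by
    simp [hC, hX]
  have h2 : (Ideal.span {C (X - C (τ x₀)), X - C (C (τ y₀))} ^ n ⊔
      Ideal.span {X ^ 2 - C (galPoly τ F)} : Ideal Qbar[X][X]) =
      (Ideal.span {C (X - C x₀), X - C (C y₀)} ^ n ⊔ Ideal.span {X ^ 2 - C F}).map e := by
    rw [Ideal.map_sup, Ideal.map_pow, Ideal.map_span, Ideal.map_span, Set.image_pair,
      Set.image_singleton]
    simp only [map_sub, map_pow, hC, hX, galPoly_X, galPoly_C]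
  rw [h1, h2, Ideal.mem_map_of_equiv]
  constructor
  · rintro ⟨a, ha, hae⟩
    rwa [← e.injective hae]
  · exact fun h => ⟨_, h, rfl⟩

theorem formOrder_galois (τ : Qbar ≃ₐ[ℚ] Qbar) (n : ℕ) (u v : Qbar[X]) (P : Pt g f) :
    formOrder n (galPoly τ u) (galPoly τ v) (P.galois τ) = formOrder n u v P := by
  cases P with
  | aff x y h =>
    simp only [formOrder, Pt.galois]
    rw [← vanishingOrder_galPoly τ _ x y u v, galPoly_fbar]
  | inf s h =>
    simp only [formOrder, Pt.galois]
    rw [← vanishingOrder_galPoly τ _ 0 s, galPoly_reflect, galPoly_reflect, galPoly_reflect,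
      galPoly_fbar, map_zero]

theorem Pt.galois_galois (σ τ : Qbar ≃ₐ[ℚ] Qbar) (P : Pt g f) :
    (P.galois τ).galois σ = P.galois (σ * τ) := by
  cases P <;> rfl

theorem Pt.galois_one (P : Pt g f) : P.galois 1 = P := by
  cases P <;> rfl

theorem Pt.galois_injective (τ : Qbar ≃ₐ[ℚ] Qbar) :
    Function.Injective (Pt.galois τ : Pt g f → Pt g f) := by
  intro P Q h
  have := congrArg (Pt.galois τ⁻¹) h
  rwa [Pt.galois_galois, Pt.galois_galois, inv_mul_cancel, Pt.galois_one, Pt.galois_one] at this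

theorem mapDomain_galois_apply (τ : Qbar ≃ₐ[ℚ] Qbar) (D : Div g f) (P : Pt g f) :
    Finsupp.mapDomain (Pt.galois τ) D (P.galois τ) = D P :=
  Finsupp.mapDomain_apply (Pt.galois_injective τ) D P

theorem mapDomain_galois_mem_principal (τ : Qbar ≃ₐ[ℚ] Qbar) {D : Div g f}
    (hD : D ∈ principal g f) : Finsupp.mapDomain (Pt.galois τ) D ∈ principal g f := by
  induction hD using AddSubgroup.closure_induction with
  | mem D hD =>
    obtain ⟨n, u, v, hn, hu, hv, huv, h⟩ := hD
    refine AddSubgroup.subset_closure ⟨n, galPoly τ u, galPoly τ v, hn, by simpa, by simpa, by simpa,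
      fun P => ?_⟩
    obtain ⟨Q, rfl⟩ : ∃ Q, P = Pt.galois τ Q :=
      ⟨P.galois τ⁻¹, by rw [Pt.galois_galois, mul_inv_cancel, Pt.galois_one]⟩
    rw [mapDomain_galois_apply, h, formOrder_galois, ← formOrder_galois τ 1 1 0 Q, map_one, map_zero]
  | zero => rw [Finsupp.mapDomain_zero]; exact zero_mem _
  | add D E _ _ hD hE => rw [Finsupp.mapDomain_add]; exact add_mem hD hE
  | neg D _ hD =>
    have : Finsupp.mapDomain (Pt.galois τ) (-D) = -Finsupp.mapDomain (Pt.galois τ) D :=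
      map_neg (Finsupp.mapDomain.addMonoidHom (Pt.galois τ)) D
    rw [this]
    exact neg_mem hD

theorem mapDomain_galois_sub (τ : Qbar ≃ₐ[ℚ] Qbar) (D E : Div g f) :
    Finsupp.mapDomain (Pt.galois τ) (D - E) =
      Finsupp.mapDomain (Pt.galois τ) D - Finsupp.mapDomain (Pt.galois τ) E :=
  map_sub (Finsupp.mapDomain.addMonoidHom (Pt.galois τ)) D E

theorem Pt.galois_invol (τ : Qbar ≃ₐ[ℚ] Qbar) (P : Pt g f) :
    P.invol.galois τ = (P.galois τ).invol := by
  cases P <;> simp [Pt.galois, Pt.invol]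

theorem mapDomain_galois_divInf (τ : Qbar ≃ₐ[ℚ] Qbar) :
    Finsupp.mapDomain (Pt.galois τ) (divInf g f) = divInf g f := by
  obtain ⟨s, hs⟩ := exists_pt_inf g f
  conv_lhs => rw [← single_add_invol_eq_divInf s hs]
  rw [Finsupp.mapDomain_add, Finsupp.mapDomain_single, Finsupp.mapDomain_single, Pt.galois_invol]
  exact single_add_invol_eq_divInf _ _

theorem mapDomain_galois_pairDiv (τ : Qbar ≃ₐ[ℚ] Qbar) (P₁ P₂ : Pt g f) :
    Finsupp.mapDomain (Pt.galois τ) (pairDiv P₁ P₂ : Div g f) =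
      pairDiv (P₁.galois τ) (P₂.galois τ) := by
  simp only [pairDiv]
  rw [mapDomain_galois_sub, mapDomain_galois_divInf, Finsupp.mapDomain_add,
    Finsupp.mapDomain_single, Finsupp.mapDomain_single]

theorem mk_eq_mk_iff (D E : degZero g f) :
    (QuotientAddGroup.mk D : Jac g f) = QuotientAddGroup.mk E ↔
      (D : Div g f) - E ∈ principal g f := by
  rw [eq_comm, QuotientAddGroup.eq, AddSubgroup.mem_addSubgroupOf, AddSubgroup.coe_add,
    AddSubgroup.coe_neg, neg_add_eq_sub]

theorem pairDiv_sub_pairDiv (P₁ P₂ Q₁ Q₂ : Pt g f) :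
    (pairDiv P₁ P₂ : Div g f) - (pairDiv Q₁ Q₂ : Div g f) =
      (Finsupp.single P₁ 1 + Finsupp.single P₂ 1) -
        (Finsupp.single Q₁ 1 + Finsupp.single Q₂ 1) :=
  sub_sub_sub_cancel_right _ _ _

theorem pairClass_comm (P₁ P₂ : Pt g f) : pairClass P₁ P₂ = pairClass P₂ P₁ := by
  rw [pairClass, pairClass, mk_eq_mk_iff, pairDiv_sub_pairDiv, add_comm, sub_self]
  exact zero_mem _

theorem pairClass_eq_iff (hf : Squarefree f)
    (hd : f.natDegree = 2 * g + 1 ∨ f.natDegree = 2 * g + 2) (hg : 2 ≤ g) {P₁ P₂ Q₁ Q₂ : Pt g f}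
    (hne : P₂ ≠ P₁.invol) : pairClass P₁ P₂ = pairClass Q₁ Q₂ ↔
      (Q₁ = P₁ ∧ Q₂ = P₂) ∨ (Q₁ = P₂ ∧ Q₂ = P₁) := by
  constructor
  · intro h
    rw [pairClass, pairClass, mk_eq_mk_iff, pairDiv_sub_pairDiv] at h
    exact eq_pair_of_sub_mem_principal hf hd hg hne h
  · rintro (⟨rfl, rfl⟩ | ⟨rfl, rfl⟩)
    · rfl
    · exact pairClass_comm _ _

theorem neg_pairClass (hf : Squarefree f)
    (hd : f.natDegree = 2 * g + 1 ∨ f.natDegree = 2 * g + 2) (P₁ P₂ : Pt g f) :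
    -pairClass P₁ P₂ = pairClass P₁.invol P₂.invol := by
  rw [pairClass, pairClass, ← QuotientAddGroup.mk_neg, eq_comm, mk_eq_mk_iff]
  have := add_mem (single_add_invol_sub_mem hf hd P₁) (single_add_invol_sub_mem hf hd P₂)
  convert this using 1
  simp only [pairDiv, AddSubgroup.coe_neg]
  abel

theorem pairClass_ne_zero (hf : Squarefree f)
    (hd : f.natDegree = 2 * g + 1 ∨ f.natDegree = 2 * g + 2) (hg : 2 ≤ g) {P₁ P₂ : Pt g f}
    (hne : P₂ ≠ P₁.invol) : pairClass P₁ P₂ ≠ 0 := by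
  obtain ⟨s, hs⟩ := exists_pt_inf g f
  intro h0
  have h : pairClass P₁ P₂ = pairClass (Pt.inf s hs) (Pt.inf s hs).invol := by
    rw [h0, eq_comm, pairClass, QuotientAddGroup.eq_zero_iff, AddSubgroup.mem_addSubgroupOf,
      pairDiv]
    simp only [single_add_invol_eq_divInf, sub_self]
    exact zero_mem _
  rcases (pairClass_eq_iff hf hd hg hne).1 h with ⟨rfl, rfl⟩ | ⟨rfl, h2⟩
  · exact hne rfl
  · rw [← h2, Pt.invol_invol] at hne
    exact hne rfl

theorem isRationalClass_pairClass_iff (hf : Squarefree f)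
    (hd : f.natDegree = 2 * g + 1 ∨ f.natDegree = 2 * g + 2) (hg : 2 ≤ g) {P₁ P₂ : Pt g f}
    (hne : P₂ ≠ P₁.invol) : IsRationalClass (pairClass P₁ P₂) ↔
      ∀ τ : Qbar ≃ₐ[ℚ] Qbar, (P₁.galois τ = P₁ ∧ P₂.galois τ = P₂) ∨
        (P₁.galois τ = P₂ ∧ P₂.galois τ = P₁) := by
  constructor
  · rintro ⟨D, hD, h⟩ τ
    rw [pairClass, mk_eq_mk_iff] at hD
    have h1 := sub_mem (sub_mem hD (mapDomain_galois_mem_principal τ hD)) (h τ)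
    rw [mapDomain_galois_sub, mapDomain_galois_pairDiv] at h1
    refine eq_pair_of_sub_mem_principal hf hd hg hne ?_
    rw [← pairDiv_sub_pairDiv]
    convert h1 using 1
    abel
  · intro h
    refine ⟨pairDiv P₁ P₂, rfl, fun τ => ?_⟩
    rw [mapDomain_galois_pairDiv, pairDiv_sub_pairDiv]
    rcases h τ with ⟨h1, h2⟩ | ⟨h1, h2⟩
    · rw [h1, h2, sub_self]; exact zero_mem _
    · rw [h1, h2, add_comm, sub_self]; exact zero_mem _

end Galois

/-! ### Quadratic points as Galois orbits of length two -/

section Quadratic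

variable {g : ℕ} {f : ℚ[X]}

instance isAlgebraic_Qbar : Algebra.IsAlgebraic ℚ Qbar := AlgebraicClosure.isAlgebraic ℚ

instance isGalois_Qbar : IsGalois ℚ Qbar :=
  have : IsAlgClosure ℚ Qbar := ⟨inferInstance, inferInstance⟩
  inferInstance

/-- A quadratic point and its conjugate are affine and have distinct irrational `x`-coordinates, and every
Galois automorphism fixes or exchanges them. -/
theorem IsQuadConj.exists_coords {P P' : Pt g f} (h : IsQuadConj P P') :
    ∃ x y x' y' hP hP', P = .aff x y hP ∧ P' = .aff x' y' hP' ∧ x ≠ x' ∧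
      x ∉ Set.range (algebraMap ℚ Qbar) ∧ x' ∉ Set.range (algebraMap ℚ Qbar) ∧
      ∀ τ : Qbar ≃ₐ[ℚ] Qbar, (P.galois τ = P ∧ P'.galois τ = P') ∨
        (P.galois τ = P' ∧ P'.galois τ = P) := by
  obtain ⟨k, hk, γ, x, y, hγ, hx, hP, hP', rfl, rfl⟩ := h
  have : Algebra.IsQuadraticExtension ℚ k := ⟨hk⟩
  have : FiniteDimensional ℚ k := Module.finite_of_finrank_pos (by omega)
  have hcard : Nat.card (k ≃ₐ[ℚ] k) = 2 := by rw [IsGalois.card_aut_eq_finrank, hk]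
  have hall : ∀ ρ : k ≃ₐ[ℚ] k, ρ = 1 ∨ ρ = γ := by
    obtain ⟨a, b, -, huniv⟩ := Nat.card_eq_two_iff.1 hcard
    have hm : ∀ c : k ≃ₐ[ℚ] k, c = a ∨ c = b := fun c => by
      have : c ∈ ({a, b} : Set _) := huniv ▸ Set.mem_univ c
      simpa using this
    intro ρ
    rcases hm ρ with h1 | h1 <;> rcases hm γ with h2 | h2 <;> rcases hm 1 with h3 | h3 <;> grind
  have hγγ : ∀ z, γ (γ z) = z := by
    intro z
    rcases hall (γ * γ) with h | h
    · exact DFunLike.congr_fun h z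
    · exact absurd (by simpa using h) hγ
  have hfix : γ x ≠ x := by
    intro h
    refine hx ((IsGalois.mem_range_algebraMap_iff_fixed x).2 fun ρ => ?_)
    rcases hall ρ with rfl | rfl
    · rfl
    · exact h
  have hrat : ∀ z : k, (z : Qbar) ∈ Set.range (algebraMap ℚ Qbar) → γ z = z := by
    rintro z ⟨r, hr⟩
    have : z = algebraMap ℚ k r := Subtype.ext hr.symm
    rw [this, γ.commutes]
  refine ⟨x, y, γ x, γ y, hP, hP', rfl, rfl, fun h => hfix (Subtype.ext h.symm),
    fun h => hfix (hrat _ h), fun h => hfix ?_, fun τ => ?_⟩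
  · have := hrat _ h
    rwa [hγγ, eq_comm] at this
  · have hτ : ∀ z : k, τ z = τ.restrictNormal k z := fun z =>
      (τ.restrictNormal_commutes k z).symm
    simp only [Pt.galois, Pt.aff.injEq, hτ]
    rcases hall (τ.restrictNormal k) with h | h <;> rw [h]
    · exact Or.inl ⟨⟨rfl, rfl⟩, rfl, rfl⟩
    · exact Or.inr ⟨⟨rfl, rfl⟩, by rw [hγγ], by rw [hγγ]⟩

theorem notMem_range_of_not_isSquare {x x' : Qbar} {a b : ℚ} (hs : x + x' = algebraMap ℚ Qbar a)
    (hp : x * x' = algebraMap ℚ Qbar b) (hsq : ¬ IsSquare (a ^ 2 - 4 * b)) :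
    x ∉ Set.range (algebraMap ℚ Qbar) := by
  rintro ⟨r, rfl⟩
  refine hsq ⟨2 * r - a, (algebraMap ℚ Qbar).injective ?_⟩
  simp only [map_sub, map_mul, map_pow, map_ofNat, ← hs, ← hp]
  ring

theorem minpoly_eq {x x' : Qbar} {a b : ℚ} (hs : x + x' = algebraMap ℚ Qbar a)
    (hp : x * x' = algebraMap ℚ Qbar b) (hx : x ∉ Set.range (algebraMap ℚ Qbar)) :
    minpoly ℚ x = X ^ 2 - C a * X + C b := by
  have hint : IsIntegral ℚ x := Algebra.IsIntegral.isIntegral x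
  have h2 : 2 ≤ (minpoly ℚ x).natDegree := (minpoly.two_le_natDegree_iff hint).2 hx
  have hdeg : (X ^ 2 - C a * X + C b).natDegree = 2 := by compute_degree!
  have hmon : (X ^ 2 - C a * X + C b).Monic := by monicity!
  refine (eq_of_monic_of_dvd_of_natDegree_le (minpoly.monic hint) hmon (minpoly.dvd ℚ x ?_)
    (by rw [hdeg]; exact h2)).symm
  simp only [map_add, map_sub, map_mul, map_pow, aeval_X, aeval_C, ← hs, ← hp]
  ring

/-- Conversely, the field of definition of such a Galois orbit is `ℚ(x)`: an automorphism that fixes `x`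
fixes `y`. -/
theorem isQuadConj_of_galois {x y x' y' : Qbar} {h h'} {a b : ℚ}
    (hs : x + x' = algebraMap ℚ Qbar a) (hp : x * x' = algebraMap ℚ Qbar b)
    (hsq : ¬ IsSquare (a ^ 2 - 4 * b))
    (hτ : ∀ τ : Qbar ≃ₐ[ℚ] Qbar, (τ x = x ∧ τ y = y) ∨ (τ x = x' ∧ τ y = y')) :
    IsQuadConj (Pt.aff x y h : Pt g f) (Pt.aff x' y' h') := by
  have hx := notMem_range_of_not_isSquare hs hp hsq
  have hxx : x ≠ x' := by
    rintro rfl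
    exact hsq ⟨0, (algebraMap ℚ Qbar).injective (by
      simp only [map_sub, map_mul, map_pow, map_ofNat, map_zero, ← hs, ← hp]; ring)⟩
  have hint : IsIntegral ℚ x := Algebra.IsIntegral.isIntegral x
  let k := IntermediateField.adjoin ℚ {x}
  have hxk : x ∈ k := IntermediateField.mem_adjoin_simple_self ℚ x
  have hk : Module.finrank ℚ k = 2 := by
    rw [IntermediateField.adjoin.finrank hint, minpoly_eq hs hp hx]
    compute_degree!
  have : Algebra.IsQuadraticExtension ℚ k := ⟨hk⟩
  have hyk : y ∈ k := by
    rw [← InfiniteGalois.fixedField_fixingSubgroup k, IntermediateField.mem_fixedField_iff]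
    intro τ hτk
    have h1 : τ x = x := (IntermediateField.mem_fixingSubgroup_iff k τ).1 hτk x hxk
    rcases hτ τ with h | h
    · exact h.2
    · exact absurd (h1.symm.trans h.1) hxx
  obtain ⟨τ, hτx⟩ : ∃ τ : Qbar ≃ₐ[ℚ] Qbar, τ x ≠ x := by
    by_contra! hc
    exact hx ((InfiniteGalois.mem_range_algebraMap_iff_fixed x).2 hc)
  obtain ⟨h1, h2⟩ := (hτ τ).resolve_left fun h => hτx h.1
  have hγ : ∀ z : k, (τ.restrictNormal k z : Qbar) = τ z := fun z =>
    τ.restrictNormal_commutes k z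
  have hγx : (τ.restrictNormal k ⟨x, hxk⟩ : Qbar) = x' := (hγ _).trans h1
  have hγy : (τ.restrictNormal k ⟨y, hyk⟩ : Qbar) = y' := (hγ _).trans h2
  refine ⟨k, hk, τ.restrictNormal k, ⟨x, hxk⟩, ⟨y, hyk⟩, ?_, ?_, h, ?_, rfl, ?_⟩
  · intro h0
    rw [h0] at hγx
    exact hxx hγx
  · rintro ⟨r, hr⟩
    exact hx ⟨r, congrArg Subtype.val hr⟩
  · rw [hγx, hγy]; exact h'
  · simp only [hγx, hγy]

end Quadratic

/-! ### Fibres consisting of classes of pairs of affine points -/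

section Fibre

variable {g : ℕ} {f : ℚ[X]}

/-- `Q` is the class of two affine points, not exchanged by the hyperelliptic involution, with
prescribed `x₁ + x₂ = a`, `x₁ x₂ = b` and last Kummer coordinate `t`. -/
def IsAffinePairClass (a b t : Qbar) (Q : Jac g f) : Prop :=
  ∃ (x₁ y₁ x₂ y₂ : Qbar) (h₁ : y₁ ^ 2 = aeval x₁ f) (h₂ : y₂ ^ 2 = aeval x₂ f),
    (Pt.aff x₂ y₂ h₂ : Pt g f) ≠ (Pt.aff x₁ y₁ h₁).invol ∧
    Q = pairClass (Pt.aff x₁ y₁ h₁) (Pt.aff x₂ y₂ h₂) ∧ x₁ + x₂ = a ∧ x₁ * x₂ = b ∧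
    lastCoord (Pt.aff x₁ y₁ h₁ : Pt g f) (Pt.aff x₂ y₂ h₂) = t

theorem lastCoord_aff_of_ne {x₁ y₁ x₂ y₂ : Qbar} {h₁ h₂} (hx : x₁ ≠ x₂) :
    lastCoord (Pt.aff x₁ y₁ h₁ : Pt g f) (Pt.aff x₂ y₂ h₂) =
      (symForm g (fun i => algebraMap ℚ Qbar (f.coeff i)) x₁ 1 x₂ 1 - 2 * y₁ * y₂) /
        (x₁ - x₂) ^ 2 := by
  rw [lastCoord, if_neg (by simpa [Pt.hX, Pt.hZ] using hx)]
  simp [Pt.hX, Pt.hY, Pt.hZ]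

theorem symForm_comm {R : Type*} [CommRing R] (g : ℕ) (c : ℕ → R) (x₁ z₁ x₂ z₂ : R) :
    symForm g c x₁ z₁ x₂ z₂ = symForm g c x₂ z₂ x₁ z₁ := by
  simp only [symForm, mul_comm x₂ x₁, mul_comm z₂ z₁, add_comm (x₂ * z₁)]

theorem lastCoord_aff_comm {x₁ y₁ x₂ y₂ : Qbar} {h₁ h₂} (hx : x₁ ≠ x₂) :
    lastCoord (Pt.aff x₁ y₁ h₁ : Pt g f) (Pt.aff x₂ y₂ h₂) =
      lastCoord (Pt.aff x₂ y₂ h₂ : Pt g f) (Pt.aff x₁ y₁ h₁) := by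
  rw [lastCoord_aff_of_ne hx, lastCoord_aff_of_ne hx.symm, symForm_comm,
    ← neg_sub x₂ x₁, neg_sq, mul_right_comm]

theorem eq_or_eq_of_add_eq_mul_eq {x₁ x₂ z₁ z₂ : Qbar} (hs : z₁ + z₂ = x₁ + x₂)
    (hp : z₁ * z₂ = x₁ * x₂) : (z₁ = x₁ ∧ z₂ = x₂) ∨ (z₁ = x₂ ∧ z₂ = x₁) := by
  have : (z₁ - x₁) * (z₁ - x₂) = 0 := by linear_combination z₁ * hs - hp
  rcases mul_eq_zero.1 this with h | h
  · exact Or.inl ⟨by linear_combination h, by linear_combination hs - h⟩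
  · exact Or.inr ⟨by linear_combination h, by linear_combination hs - h⟩

/-- Away from `x₁ = x₂`, the Kummer coordinates determine the class up to sign: the last one determines
`y₁ y₂`, so that the signs of `y₁` and `y₂` can only change together, or one of `y₁`, `y₂` is zero. -/
theorem isAffinePairClass_iff (hf : Squarefree f)
    (hd : f.natDegree = 2 * g + 1 ∨ f.natDegree = 2 * g + 2) {x₁ y₁ x₂ y₂ : Qbar}
    {h₁ : y₁ ^ 2 = aeval x₁ f} {h₂ : y₂ ^ 2 = aeval x₂ f} (hx : x₁ ≠ x₂) {Q : Jac g f} :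
    IsAffinePairClass (x₁ + x₂) (x₁ * x₂)
      (lastCoord (Pt.aff x₁ y₁ h₁ : Pt g f) (Pt.aff x₂ y₂ h₂)) Q ↔
        Q = pairClass (Pt.aff x₁ y₁ h₁) (Pt.aff x₂ y₂ h₂) ∨
          Q = -pairClass (Pt.aff x₁ y₁ h₁) (Pt.aff x₂ y₂ h₂) := by
  constructor
  · rintro ⟨z₁, w₁, z₂, w₂, e₁, e₂, -, rfl, hs, hp, ht⟩
    wlog hz : z₁ = x₁ ∧ z₂ = x₂ generalizing z₁ w₁ z₂ w₂
    · have hz' := (eq_or_eq_of_add_eq_mul_eq hs hp).resolve_left hz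
      rw [pairClass_comm]
      refine this z₂ w₂ z₁ w₁ e₂ e₁ (by rw [add_comm, hs]) (by rw [mul_comm, hp]) ?_ hz'.symm
      rw [lastCoord_aff_comm (by rw [hz'.1, hz'.2]; exact hx), ht]
    obtain ⟨rfl, rfl⟩ := hz
    rw [lastCoord_aff_of_ne hx, lastCoord_aff_of_ne hx,
      div_left_inj' (pow_ne_zero 2 (sub_ne_zero.2 hx))] at ht
    have hw : w₁ * w₂ = y₁ * y₂ := by linear_combination -ht / 2
    have hw₁ := sq_eq_sq_iff_eq_or_eq_neg.1 (e₁.trans h₁.symm)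
    have hw₂ := sq_eq_sq_iff_eq_or_eq_neg.1 (e₂.trans h₂.symm)
    have : (w₁ = y₁ ∧ w₂ = y₂) ∨ (w₁ = -y₁ ∧ w₂ = -y₂) := by
      rcases hw₁ with rfl | rfl <;> rcases hw₂ with rfl | rfl
      · exact Or.inl ⟨rfl, rfl⟩
      · have : w₁ * y₂ = 0 := by linear_combination -hw / 2
        rcases mul_eq_zero.1 this with rfl | rfl <;> simp
      · have : y₁ * w₂ = 0 := by linear_combination -hw / 2
        rcases mul_eq_zero.1 this with rfl | rfl <;> simp
      · exact Or.inr ⟨rfl, rfl⟩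
    rw [neg_pairClass hf hd]
    rcases this with ⟨rfl, rfl⟩ | ⟨rfl, rfl⟩
    · exact Or.inl rfl
    · exact Or.inr rfl
  · rintro (rfl | rfl)
    · refine ⟨x₁, y₁, x₂, y₂, h₁, h₂, ?_, rfl, rfl, rfl, rfl⟩
      simp [Pt.invol, hx.symm]
    · refine ⟨x₁, -y₁, x₂, -y₂, by rw [neg_sq, h₁], by rw [neg_sq, h₂], ?_,
        neg_pairClass hf hd _ _, rfl, rfl, ?_⟩
      · simp [Pt.invol, hx.symm]
      · rw [lastCoord_aff_of_ne hx, lastCoord_aff_of_ne hx]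
        ring

theorem IsConjFiber.coords (hf : Squarefree f)
    (hd : f.natDegree = 2 * g + 1 ∨ f.natDegree = 2 * g + 2) (hg : 2 ≤ g) {S : Set (Jac g f)}
    {a b t : Qbar} (hS : ∀ Q ∈ S, IsAffinePairClass a b t Q) {P P' : Pt g f}
    (h : IsConjFiber S P P') : P.xCoord + P'.xCoord = a ∧ P.xCoord * P'.xCoord = b := by
  obtain ⟨hq, rfl⟩ := h
  obtain ⟨x₁, y₁, x₂, y₂, h₁, h₂, hne, hQ, rfl, rfl, -⟩ := hS (pairClass P P') (by simp)
  rcases (pairClass_eq_iff hf hd hg hne).1 hQ.symm with ⟨rfl, rfl⟩ | ⟨rfl, rfl⟩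
  · simp [Pt.xCoord, Pt.hX, Pt.hZ]
  · simp [Pt.xCoord, Pt.hX, Pt.hZ, add_comm, mul_comm]

theorem IsQuadConj.ne_invol {P P' : Pt g f} (h : IsQuadConj P P') : P' ≠ P.invol := by
  obtain ⟨x, y, x', y', hP, hP', rfl, rfl, hne, -⟩ := h.exists_coords
  simp [Pt.invol, hne.symm]

theorem IsConjFiber.exists_isRationalClass (hf : Squarefree f)
    (hd : f.natDegree = 2 * g + 1 ∨ f.natDegree = 2 * g + 2) (hg : 2 ≤ g) {S : Set (Jac g f)}
    {P P' : Pt g f} (h : IsConjFiber S P P') : ∃ Q ∈ S, IsRationalClass Q := by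
  obtain ⟨hq, rfl⟩ := h
  refine ⟨pairClass P P', by simp, (isRationalClass_pairClass_iff hf hd hg hq.ne_invol).2 ?_⟩
  obtain ⟨x, y, x', y', hP, hP', rfl, rfl, -, -, -, h⟩ := hq.exists_coords
  exact h

theorem IsQuadConj.not_isSquare {P P' : Pt g f} (h : IsQuadConj P P') {a b : ℚ}
    (hs : P.xCoord + P'.xCoord = algebraMap ℚ Qbar a)
    (hp : P.xCoord * P'.xCoord = algebraMap ℚ Qbar b) :
    b ≠ 0 ∧ ¬ IsSquare (a ^ 2 - 4 * b) := by
  obtain ⟨x, y, x', y', hP, hP', rfl, rfl, hne, hx, hx', -⟩ := h.exists_coords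
  simp only [Pt.xCoord, Pt.hX, Pt.hZ, div_one] at hs hp
  constructor
  · rintro rfl
    rw [map_zero, mul_eq_zero] at hp
    rcases hp with rfl | rfl
    · exact hx ⟨0, map_zero _⟩
    · exact hx' ⟨0, map_zero _⟩
  · rintro ⟨r, hr⟩
    have hr' : (x - x') ^ 2 = algebraMap ℚ Qbar r ^ 2 := by
      rw [← map_pow, pow_two r, ← hr]
      simp only [map_sub, map_mul, map_pow, map_ofNat, ← hs, ← hp]
      ring
    rcases sq_eq_sq_iff_eq_or_eq_neg.1 hr' with h | h
    · refine hx ⟨(a + r) / 2, ?_⟩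
      rw [map_div₀, map_add, ← hs, ← h, map_ofNat]
      ring
    · refine hx ⟨(a - r) / 2, ?_⟩
      rw [map_div₀, map_sub, ← hs, sub_eq_add_neg, ← h, map_ofNat]
      ring

theorem exists_isConjFiber (hf : Squarefree f)
    (hd : f.natDegree = 2 * g + 1 ∨ f.natDegree = 2 * g + 2) (hg : 2 ≤ g) {S : Set (Jac g f)}
    {a b : ℚ} {t : Qbar}
    (hS : ∀ Q, Q ∈ S ↔ IsAffinePairClass (algebraMap ℚ Qbar a) (algebraMap ℚ Qbar b) t Q)
    (hsq : ¬ IsSquare (a ^ 2 - 4 * b)) (hQ : ∃ Q ∈ S, IsRationalClass Q) :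
    ∃ P P', IsConjFiber S P P' := by
  obtain ⟨Q, hQS, hrat⟩ := hQ
  obtain ⟨x₁, y₁, x₂, y₂, h₁, h₂, hne, rfl, hs, hp, rfl⟩ := (hS Q).1 hQS
  rw [isRationalClass_pairClass_iff hf hd hg hne] at hrat
  have hxx : x₁ ≠ x₂ := by
    rintro rfl
    exact hsq ⟨0, (algebraMap ℚ Qbar).injective (by
      simp only [map_sub, map_mul, map_pow, map_ofNat, map_zero, ← hs, ← hp]; ring)⟩
  refine ⟨Pt.aff x₁ y₁ h₁, Pt.aff x₂ y₂ h₂, isQuadConj_of_galois hs hp hsq fun τ => ?_, ?_⟩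
  · simp only [Pt.galois, Pt.aff.injEq] at hrat
    exact (hrat τ).imp And.left And.left
  · ext Q
    rw [hS, ← hs, ← hp, isAffinePairClass_iff hf hd hxx]
    rfl

theorem IsQuadConj.isWeierstrass_iff {P P' : Pt g f} (h : IsQuadConj P P') {a b : ℚ}
    (hs : P.xCoord + P'.xCoord = algebraMap ℚ Qbar a)
    (hp : P.xCoord * P'.xCoord = algebraMap ℚ Qbar b) :
    P.IsWeierstrass ↔ X ^ 2 - C a * X + C b ∣ f := by
  obtain ⟨x, y, x', y', hP, hP', rfl, rfl, hne, hx, hx', -⟩ := h.exists_coords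
  simp only [Pt.xCoord, Pt.hX, Pt.hZ, div_one] at hs hp
  rw [Pt.IsWeierstrass, Pt.invol_eq_self_iff, ← minpoly_eq hs hp hx, minpoly.dvd_iff, ← hP]
  simp [Pt.hY]

end Fibre

/-! ### The fibres of the Kummer maps in genus 2 and 3 -/

section Kummer

variable {f : ℚ[X]}

theorem Pt.exists_eq_aff {g : ℕ} {P : Pt g f} (h : P.hZ ≠ 0) : ∃ x y h, P = .aff x y h := by
  cases P with
  | aff x y hxy => exact ⟨x, y, hxy, rfl⟩
  | inf s h' => exact absurd rfl h

theorem mem_kummerFiber₂_iff {σ₂ σ₃ β₀ : ℚ} {Q : Jac 2 f} :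
    Q ∈ kummerFiber₂ f ![1, σ₂, σ₃, β₀] ↔
      IsAffinePairClass (algebraMap ℚ Qbar σ₂) (algebraMap ℚ Qbar σ₃) (algebraMap ℚ Qbar β₀) Q := by
  constructor
  · rintro ⟨w, ⟨-, rfl⟩ | ⟨P₁, P₂, hne, rfl, rfl⟩, c, hc, hw⟩
    · have := hw 0
      simp at this
    · have h0 := hw 0
      have h1 := hw 1
      have h2 := hw 2
      have h3 := hw 3
      simp only [Matrix.cons_val, map_one] at h0 h1 h2 h3
      obtain ⟨x₁, y₁, e₁, rfl⟩ := Pt.exists_eq_aff (P := P₁) (by rintro h; simp [h] at h0)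
      obtain ⟨x₂, y₂, e₂, rfl⟩ := Pt.exists_eq_aff (P := P₂) (by rintro h; simp [h] at h0)
      simp only [Pt.hX, Pt.hZ, mul_one] at h0 h1 h2
      subst h0
      exact ⟨x₁, y₁, x₂, y₂, e₁, e₂, hne, rfl, by rw [h1, one_mul], by rw [h2, one_mul],
        by rw [h3, one_mul]⟩
  · rintro ⟨x₁, y₁, x₂, y₂, h₁, h₂, hne, rfl, hs, hp, ht⟩
    refine ⟨_, Or.inr ⟨_, _, hne, rfl, rfl⟩, 1, one_ne_zero, fun i => ?_⟩
    fin_cases i <;> simp [Pt.hX, Pt.hZ, hs, hp, ht]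

/-- As the first coordinate is `0`, the divisors of degree four do not occur. -/
theorem exists_of_mem_kummerFiber₃ {σ₂ σ₃ σ₄ σ₅ σ₆ σ₇ σ₈ : ℚ} {Q : Jac 3 f}
    (hQ : Q ∈ kummerFiber₃ f ![0, σ₂, σ₃, σ₄, σ₅, σ₆, σ₇, σ₈]) :
    (Q = 0 ∧ σ₂ = 0) ∨ ∃ (P₁ P₂ : Pt 3 f) (c : Qbar), c ≠ 0 ∧ P₂ ≠ P₁.invol ∧ Q = pairClass P₁ P₂ ∧
      let a₀ := P₁.hZ * P₂.hZ
      let a₁ := -(P₁.hX * P₂.hZ + P₂.hX * P₁.hZ)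
      let a₂ := P₁.hX * P₂.hX
      ∀ i, algebraMap ℚ Qbar (![0, σ₂, σ₃, σ₄, σ₅, σ₆, σ₇, σ₈] i) =
        c * ![0, a₀ ^ 2, a₀ * a₁, a₀ * a₂, a₁ ^ 2 - a₀ * a₂, a₁ * a₂, a₂ ^ 2,
          -lastCoord P₁ P₂] i := by
  obtain ⟨w, ⟨rfl, rfl⟩ | ⟨P₁, P₂, hne, rfl, rfl⟩ | ⟨D, E, A, B, C', h⟩, c, hc, hw⟩ := hQ
  · exact Or.inl ⟨rfl, by simpa using hw 1⟩
  · exact Or.inr ⟨P₁, P₂, c, hc, hne, rfl, hw⟩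
  · obtain ⟨-, -, -, -, -, -, -, -, -, rfl⟩ := h
    have := hw 0
    exact absurd (by simpa using this.symm) hc

/-- The coordinates `σ₅`, `σ₆`, `σ₇` are determined by `σ₂`, `σ₃`, `σ₄` on the image of `κ`; this is
where the fibre has to be nonempty. -/
theorem mem_kummerFiber₃_iff {σ₂ σ₃ σ₄ σ₅ σ₆ σ₇ σ₈ : ℚ} (hσ : σ₂ ≠ 0)
    (hne : (kummerFiber₃ f ![0, σ₂, σ₃, σ₄, σ₅, σ₆, σ₇, σ₈]).Nonempty) (Q : Jac 3 f) :
    Q ∈ kummerFiber₃ f ![0, σ₂, σ₃, σ₄, σ₅, σ₆, σ₇, σ₈] ↔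
      IsAffinePairClass (algebraMap ℚ Qbar (-σ₃ / σ₂)) (algebraMap ℚ Qbar (σ₄ / σ₂))
        (algebraMap ℚ Qbar (-σ₈ / σ₂)) Q := by
  have hσ' : algebraMap ℚ Qbar σ₂ ≠ 0 := by simpa using hσ
  have key : ∀ Q ∈ kummerFiber₃ f ![0, σ₂, σ₃, σ₄, σ₅, σ₆, σ₇, σ₈],
      IsAffinePairClass (algebraMap ℚ Qbar (-σ₃ / σ₂)) (algebraMap ℚ Qbar (σ₄ / σ₂))
        (algebraMap ℚ Qbar (-σ₈ / σ₂)) Q ∧ σ₂ * σ₅ = σ₃ ^ 2 - σ₂ * σ₄ ∧ σ₂ * σ₆ = σ₃ * σ₄ ∧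
        σ₂ * σ₇ = σ₄ ^ 2 := by
    intro Q hQ
    rcases exists_of_mem_kummerFiber₃ hQ with ⟨-, h⟩ | ⟨P₁, P₂, c, hc, hne, rfl, hw⟩
    · exact absurd h hσ
    have w1 := hw 1
    have w2 := hw 2
    have w3 := hw 3
    have w4 := hw 4
    have w5 := hw 5
    have w6 := hw 6
    have w7 := hw 7
    simp only [Matrix.cons_val] at w1 w2 w3 w4 w5 w6 w7
    obtain ⟨x₁, y₁, e₁, rfl⟩ := Pt.exists_eq_aff (P := P₁) (by
      rintro h; rw [h] at w1; simp [hσ] at w1)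
    obtain ⟨x₂, y₂, e₂, rfl⟩ := Pt.exists_eq_aff (P := P₂) (by
      rintro h; rw [h] at w1; simp [hσ] at w1)
    simp only [Pt.hX, Pt.hZ, mul_one, one_pow, one_mul] at w1 w2 w3 w4 w5 w6
    subst w1
    refine ⟨⟨x₁, y₁, x₂, y₂, e₁, e₂, hne, rfl, ?_, ?_, ?_⟩, ?_, ?_, ?_⟩
    · rw [map_div₀, map_neg, w2]; field_simp
    · rw [map_div₀, w3]; field_simp
    · rw [map_div₀, map_neg, w7]; field_simp
    all_goals
      apply (algebraMap ℚ Qbar).injective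
      simp only [map_mul, map_sub, map_pow, w2, w3, w4, w5, w6]
      ring
  obtain ⟨Q₀, hQ₀⟩ := hne
  obtain ⟨-, k5, k6, k7⟩ := key Q₀ hQ₀
  refine ⟨fun hQ => (key Q hQ).1, ?_⟩
  rintro ⟨x₁, y₁, x₂, y₂, e₁, e₂, hne, rfl, hs, hp, ht⟩
  refine ⟨_, Or.inr (Or.inl ⟨_, _, hne, rfl, rfl⟩), algebraMap ℚ Qbar σ₂, hσ', fun i => ?_⟩
  have h5 : σ₅ = σ₂ * ((-σ₃ / σ₂) ^ 2 - σ₄ / σ₂) := by field_simp; linear_combination k5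
  have h6 : σ₆ = σ₂ * ((σ₃ / σ₂) * (σ₄ / σ₂)) := by field_simp; linear_combination k6
  have h7 : σ₇ = σ₂ * (σ₄ / σ₂) ^ 2 := by field_simp; linear_combination k7
  rw [h5, h6, h7]
  fin_cases i
  all_goals
    simp only [Pt.hX, Pt.hZ, mul_one, one_pow, one_mul, hs, hp, ht, Matrix.cons_val, Fin.mk_one,
      Fin.zero_eta, Fin.reduceFinMk, ← map_mul, ← map_neg, ← map_pow, ← map_sub, map_zero, mul_zero]
  all_goals
    congr 1
    try field_simp

/-- The coordinate `σ₂` vanishes only for `Q = 0` and when one of the two points is at infinity. -/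
theorem ne_zero_of_isConjFiber_kummerFiber₃ (hf : Squarefree f)
    (hd : f.natDegree = 2 * 3 + 1 ∨ f.natDegree = 2 * 3 + 2) {σ₂ σ₃ σ₄ σ₅ σ₆ σ₇ σ₈ : ℚ}
    {P P' : Pt 3 f} (h : IsConjFiber (kummerFiber₃ f ![0, σ₂, σ₃, σ₄, σ₅, σ₆, σ₇, σ₈]) P P') :
    σ₂ ≠ 0 := by
  obtain ⟨hq, hS⟩ := h
  have hg : 2 ≤ 3 := by norm_num
  have hmem : pairClass P P' ∈ kummerFiber₃ f ![0, σ₂, σ₃, σ₄, σ₅, σ₆, σ₇, σ₈] := by simp [hS]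
  have hne := hq.ne_invol
  rcases exists_of_mem_kummerFiber₃ hmem with ⟨h0, -⟩ | ⟨P₁, P₂, c, hc, -, hQ, hw⟩
  · exact absurd h0 (pairClass_ne_zero hf hd hg hne)
  obtain ⟨x, y, x', y', hP, hP', rfl, rfl, -⟩ := hq.exists_coords
  rintro rfl
  have := hw 1
  rcases (pairClass_eq_iff hf hd hg hne).1 hQ with ⟨rfl, rfl⟩ | ⟨rfl, rfl⟩ <;>
  · simp [Pt.hZ] at this
    exact hc this.symm

end Kummer

theorem isSquare_scale_iff {a b c : ℚ} (ha : a ≠ 0) :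
    IsSquare ((-b / a) ^ 2 - 4 * (c / a)) ↔ IsSquare (b ^ 2 - 4 * a * c) := by
  have e : b ^ 2 - 4 * a * c = ((-b / a) ^ 2 - 4 * (c / a)) * (a * a) := by field_simp
  rw [e]
  constructor
  · exact fun h => h.mul ⟨a, rfl⟩
  · intro h
    have := h.div (⟨a, rfl⟩ : IsSquare (a * a))
    rwa [mul_div_cancel_right₀ _ (mul_ne_zero ha ha)] at this

theorem quadratic_dvd_iff {a b c : ℚ} (ha : a ≠ 0) {f : ℚ[X]} :
    X ^ 2 - C (-b / a) * X + C (c / a) ∣ f ↔ C a * X ^ 2 + C b * X + C c ∣ f := by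
  have e : C a * X ^ 2 + C b * X + C c = C a * (X ^ 2 - C (-b / a) * X + C (c / a)) := by
    have hb : C b = C a * C (b / a) := by rw [← C_mul]; congr 1; field_simp
    have hc : C c = C a * C (c / a) := by rw [← C_mul]; congr 1; field_simp
    rw [hb, hc, neg_div, C_neg]
    ring
  rw [e, (isUnit_C.2 ha.isUnit).mul_left_dvd]

end HyperellipticKummer

open HyperellipticKummer in
theorem theorem5p1 :
    -- genus 2
    (∀ f : Polynomial ℚ, Squarefree f → (f.natDegree = 5 ∨ f.natDegree = 6) →
      ∀ σ₂ σ₃ β₀ : ℚ, (kummerFiber₂ f ![1, σ₂, σ₃, β₀]).Nonempty →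
        ((∃ P P', IsConjFiber (kummerFiber₂ f ![1, σ₂, σ₃, β₀]) P P') ↔
          (∃ Q ∈ kummerFiber₂ f ![1, σ₂, σ₃, β₀], IsRationalClass Q) ∧
            σ₃ ≠ 0 ∧ ¬ IsSquare (σ₂ ^ 2 - 4 * σ₃)) ∧
        (∀ P P', IsConjFiber (kummerFiber₂ f ![1, σ₂, σ₃, β₀]) P P' →
          ∀ s : Qbar, s ^ 2 = algebraMap ℚ Qbar (σ₂ ^ 2 - 4 * σ₃) →
            (P.xCoord = (algebraMap ℚ Qbar σ₂ + s) / 2 ∧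
              P'.xCoord = (algebraMap ℚ Qbar σ₂ - s) / 2) ∨
            (P.xCoord = (algebraMap ℚ Qbar σ₂ - s) / 2 ∧
              P'.xCoord = (algebraMap ℚ Qbar σ₂ + s) / 2))) ∧
    -- genus 3
    (∀ f : Polynomial ℚ, Squarefree f → (f.natDegree = 7 ∨ f.natDegree = 8) →
      ∀ σ₂ σ₃ σ₄ σ₅ σ₆ σ₇ σ₈ : ℚ,
        (kummerFiber₃ f ![0, σ₂, σ₃, σ₄, σ₅, σ₆, σ₇, σ₈]).Nonempty →
        ((∃ P P', IsConjFiber (kummerFiber₃ f ![0, σ₂, σ₃, σ₄, σ₅, σ₆, σ₇, σ₈]) P P') ↔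
          (∃ Q ∈ kummerFiber₃ f ![0, σ₂, σ₃, σ₄, σ₅, σ₆, σ₇, σ₈], IsRationalClass Q) ∧
            σ₂ ≠ 0 ∧ σ₄ ≠ 0 ∧ ¬ IsSquare (σ₃ ^ 2 - 4 * σ₂ * σ₄)) ∧
        ((∃ P P', IsConjFiber (kummerFiber₃ f ![0, σ₂, σ₃, σ₄, σ₅, σ₆, σ₇, σ₈]) P P' ∧
            ¬ P.IsWeierstrass) ↔
          (∃ Q ∈ kummerFiber₃ f ![0, σ₂, σ₃, σ₄, σ₅, σ₆, σ₇, σ₈], IsRationalClass Q) ∧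
            σ₂ ≠ 0 ∧ σ₄ ≠ 0 ∧ ¬ IsSquare (σ₃ ^ 2 - 4 * σ₂ * σ₄) ∧
            ¬ (Polynomial.C σ₂ * Polynomial.X ^ 2 + Polynomial.C σ₃ * Polynomial.X +
                Polynomial.C σ₄ ∣ f)) ∧
        (∀ P P', IsConjFiber (kummerFiber₃ f ![0, σ₂, σ₃, σ₄, σ₅, σ₆, σ₇, σ₈]) P P' →
          ∀ s : Qbar, s ^ 2 = algebraMap ℚ Qbar (σ₃ ^ 2 - 4 * σ₂ * σ₄) →
            (P.xCoord = (-algebraMap ℚ Qbar σ₃ + s) / (2 * algebraMap ℚ Qbar σ₂) ∧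
              P'.xCoord = (-algebraMap ℚ Qbar σ₃ - s) / (2 * algebraMap ℚ Qbar σ₂)) ∨
            (P.xCoord = (-algebraMap ℚ Qbar σ₃ - s) / (2 * algebraMap ℚ Qbar σ₂) ∧
              P'.xCoord = (-algebraMap ℚ Qbar σ₃ + s) / (2 * algebraMap ℚ Qbar σ₂)))) := by
  refine ⟨fun f hf hdeg σ₂ σ₃ β₀ hne => ?_, fun f hf hdeg σ₂ σ₃ σ₄ σ₅ σ₆ σ₇ σ₈ hne => ?_⟩
  · have hd : f.natDegree = 2 * 2 + 1 ∨ f.natDegree = 2 * 2 + 2 := hdeg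
    have hS : ∀ Q, Q ∈ kummerFiber₂ f ![1, σ₂, σ₃, β₀] ↔ _ := fun Q => mem_kummerFiber₂_iff
    have hco : ∀ P P', IsConjFiber (kummerFiber₂ f ![1, σ₂, σ₃, β₀]) P P' → _ := fun P P' h =>
      h.coords hf hd le_rfl fun Q => (hS Q).1
    refine ⟨⟨?_, ?_⟩, ?_⟩
    · rintro ⟨P, P', h⟩
      exact ⟨h.exists_isRationalClass hf hd le_rfl,
        h.1.not_isSquare (hco P P' h).1 (hco P P' h).2⟩
    · rintro ⟨hQ, -, hsq⟩
      exact exists_isConjFiber hf hd le_rfl hS hsq hQ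
    · intro P P' h s hs
      obtain ⟨h1, h2⟩ := hco P P' h
      have : s ^ 2 = (P.xCoord - P'.xCoord) ^ 2 := by
        rw [hs]
        simp only [map_sub, map_mul, map_pow, map_ofNat, ← h1, ← h2]
        ring
      rw [← h1]
      rcases sq_eq_sq_iff_eq_or_eq_neg.1 this with rfl | rfl
      · exact Or.inl ⟨by ring, by ring⟩
      · exact Or.inr ⟨by ring, by ring⟩
  · have hd : f.natDegree = 2 * 3 + 1 ∨ f.natDegree = 2 * 3 + 2 := hdeg
    have hg : 2 ≤ 3 := by norm_num
    set S := kummerFiber₃ f ![0, σ₂, σ₃, σ₄, σ₅, σ₆, σ₇, σ₈] with hSdef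
    have hσ : ∀ P P', IsConjFiber S P P' → σ₂ ≠ 0 := fun P P' h =>
      ne_zero_of_isConjFiber_kummerFiber₃ hf hd h
    have hS : σ₂ ≠ 0 → ∀ Q, Q ∈ S ↔ _ := fun h Q => mem_kummerFiber₃_iff h hne Q
    have hco : ∀ P P', IsConjFiber S P P' → _ := fun P P' h =>
      h.coords hf hd hg fun Q => (hS (hσ P P' h) Q).1
    have hfwd : ∀ P P', IsConjFiber S P P' → (∃ Q ∈ S, IsRationalClass Q) ∧ σ₂ ≠ 0 ∧ σ₄ ≠ 0 ∧
        ¬ IsSquare (σ₃ ^ 2 - 4 * σ₂ * σ₄) := by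
      intro P P' h
      obtain ⟨h1, h2⟩ := h.1.not_isSquare (hco P P' h).1 (hco P P' h).2
      rw [isSquare_scale_iff (hσ P P' h)] at h2
      exact ⟨h.exists_isRationalClass hf hd hg, hσ P P' h, fun h0 => h1 (by rw [h0, zero_div]), h2⟩
    have hbwd : (∃ Q ∈ S, IsRationalClass Q) → σ₂ ≠ 0 → ¬ IsSquare (σ₃ ^ 2 - 4 * σ₂ * σ₄) →
        ∃ P P', IsConjFiber S P P' := fun hQ h0 hsq =>
      exists_isConjFiber hf hd hg (hS h0) (by rwa [isSquare_scale_iff h0]) hQ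
    have hW : ∀ P P', IsConjFiber S P P' → (P.IsWeierstrass ↔ C σ₂ * X ^ 2 + C σ₃ * X + C σ₄ ∣ f) :=
      fun P P' h => by
        rw [h.1.isWeierstrass_iff (hco P P' h).1 (hco P P' h).2, quadratic_dvd_iff (hσ P P' h)]
    refine ⟨⟨?_, ?_⟩, ⟨?_, ?_⟩, ?_⟩
    · rintro ⟨P, P', h⟩
      exact hfwd P P' h
    · rintro ⟨hQ, h0, -, hsq⟩
      exact hbwd hQ h0 hsq
    · rintro ⟨P, P', h, hP⟩
      obtain ⟨h1, h2, h3, h4⟩ := hfwd P P' h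
      exact ⟨h1, h2, h3, h4, fun hdvd => hP ((hW P P' h).2 hdvd)⟩
    · rintro ⟨hQ, h0, -, hsq, hdvd⟩
      obtain ⟨P, P', h⟩ := hbwd hQ h0 hsq
      exact ⟨P, P', h, fun hP => hdvd ((hW P P' h).1 hP)⟩
    · intro P P' h s hs
      obtain ⟨h1, h2⟩ := hco P P' h
      have h0 : algebraMap ℚ Qbar σ₂ ≠ 0 := by simpa using hσ P P' h
      rw [map_div₀, map_neg, eq_div_iff h0] at h1
      rw [map_div₀, eq_div_iff h0] at h2
      have : s ^ 2 = (algebraMap ℚ Qbar σ₂ * (P.xCoord - P'.xCoord)) ^ 2 := by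
        rw [hs]
        simp only [map_sub, map_mul, map_pow, map_ofNat, ← h2, ← neg_eq_iff_eq_neg.2 h1]
        ring
      rw [← h1]
      rcases sq_eq_sq_iff_eq_or_eq_neg.1 this with rfl | rfl
      · exact Or.inl ⟨by field_simp; ring, by field_simp; ring⟩
      · exact Or.inr ⟨by field_simp; ring, by field_simp; ring⟩
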